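/- **Model.** Fix $K=2$ arms and a dimension $d$. An *instance* of the linear contextual bandit problem (with adversarial contexts chosen by an oblivious adversary) consists of a hidden vector $\theta\in\mathbb R^d$ with $\|\theta\|_2\le 1$, for each round $t$ a probability distribution $\mathcal D_t$ of the pair of context vectors $X_t=(x_{t,1},x_{t,2})\in(\mathbb R^d)^2$ with $\|x_{t,i}\|_2\le 1$ almost surely, and for each round a noise distribution that is sub-Gaussian with variance proxy at most $1$; the contexts of different rounds and the noises are independent. A (randomized) *learner*, which may depend on $d$ and on the horizon $T$, draws a random seed once; in each round $t=1,\dots,T$ it first fixes, as a function of the seed and of the contexts, arms and rewards of the earlier rounds, a policy $\chi_t$, i.e. a map from tuples of context vectors to probability distributions on the arms. Then $X_t\sim\mathcal D_t$ is revealed, an arm $i_t\sim\chi_t(X_t)$ is played, and the reward $\theta^\top x_{t,i_t}+\varepsilon_t$ is received. A *policy switch* occurs in round $1$ and in each round $t>1$ with $\chi_t\ne\chi_{t-1}$. The *expected regret* is $R^T=\mathbb E\big[\sum_{t=1}^T\big(\max_i \theta^\top x_{t,i}-\theta^\top x_{t,i_t}\big)\big]$. **Theorem.** 1. There is an absolute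 constant $C>0$ such that the following holds for every even $d\ge 2$, every $T\ge Cd$ and every real $M$ with $20d\le M\le \frac{d\ln T}{48}$. For every learner whose expected number of policy switches in $T$ rounds is at most $M$ on every instance, there is an instance on which its expected regret is at least $$\sqrt{dT}\cdot\frac1{32d}\Big(\frac{2T}{d}\Big)^{1/(16M/d+2)} .$$ 2. Consequently $\Omega\big(d\log T/\log(d\log T)\big)$ switches are needed for $\sqrt{dT}\cdot\mathrm{poly}\log T$ regret: for every $a\ge 0$ there is $c>0$ such that for every $G>0$ there is $T_0>0$ such that, for every even $d\ge2$ and every $T\ge T_0$ with $T\ge T_0\,d^2(\ln T)^{2a}$, every learner whose expected regret in $T$ rounds is at most $G\sqrt{dT}\,(\ln T)^a$ on every instance makes, on some instance, at least $c\,\dfrac{d\ln T}{\ln(d\ln T)}$ policy switches in expectation. -/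

import Mathlib

open MeasureTheory ProbabilityTheory
open scoped ENNReal NNReal

namespace LinBandit

universe u

/-- The context vectors `x₁, …, x_K ∈ ℝ^d` shown to the learner in one round. -/
abbrev Contexts (d K : ℕ) : Type := Fin K → EuclideanSpace ℝ (Fin d)

/-- What the learner has seen after one round: the contexts, the played arm, the reward. -/
abbrev Round (d K : ℕ) : Type := Contexts d K × Fin K × ℝ

/-- The observations of the first `t` rounds. Rounds are numbered `0, 1, 2, …`. -/
abbrev History (d K t : ℕ) : Type := Fin t → Round d K

/-- An instance of the linear contextual bandit problem with an oblivious adversary: a hidden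
vector `θ`, for every round a law of the (jointly drawn) context vectors, and for every round
a law of the noise, sub-Gaussian with variance proxy `1` (which entails mean zero).
Contexts of different rounds and all the noises are independent, see `Learner.law`. -/
structure Instance (d K : ℕ) where
  θ : EuclideanSpace ℝ (Fin d)
  norm_θ_le : ‖θ‖ ≤ 1
  contextLaw : ℕ → Measure (Contexts d K)
  isProb_contextLaw : ∀ t, IsProbabilityMeasure (contextLaw t)
  norm_context_le : ∀ t, ∀ᵐ X ∂(contextLaw t), ∀ i, ‖X i‖ ≤ 1
  noise : ℕ → Measure ℝ
  isProb_noise : ∀ t, IsProbabilityMeasure (noise t)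
  noise_subG : ∀ t, HasSubgaussianMGF (fun e : ℝ => e) 1 (noise t)

attribute [instance] Instance.isProb_contextLaw Instance.isProb_noise

/-- A (randomized, adaptive) learner. It draws a random seed once. From the seed and the history
of the first `t` rounds it determines its policy for the next round, which sends each tuple of
context vectors to a probability distribution on the arms. The policy is fixed before the
contexts of that round are seen. -/
structure Learner (d K : ℕ) where
  Seed : Type u
  measurableSpaceSeed : MeasurableSpace Seed
  seedLaw : Measure Seed
  isProb_seedLaw : IsProbabilityMeasure seedLaw
  policy : ∀ t : ℕ, Kernel ((Seed × History d K t) × Contexts d K) (Fin K)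
  isMarkov_policy : ∀ t, IsMarkovKernel (policy t)

attribute [instance] Learner.measurableSpaceSeed Learner.isProb_seedLaw Learner.isMarkov_policy

variable {d K : ℕ}

theorem measurable_meanReward (θ : EuclideanSpace ℝ (Fin d)) :
    Measurable (fun p : Contexts d K × Fin K => inner ℝ (p.1 p.2) θ) := by
  refine measurable_from_prod_countable_left fun i => ?_
  fun_prop

/-- The law of the reward `⟨x_i, θ⟩ + ε` of the round `t`, given the contexts and the arm `i`. -/
noncomputable def Instance.rewardKernel (B : Instance d K) (t : ℕ) :
    Kernel (Contexts d K × Fin K) ℝ :=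
  ((Kernel.deterministic _ (measurable_meanReward B.θ)) ×ₖ (Kernel.const _ (B.noise t))).map
    (fun p : ℝ × ℝ => p.1 + p.2)

instance (B : Instance d K) (t : ℕ) : IsMarkovKernel (B.rewardKernel t) := by
  unfold Instance.rewardKernel
  exact Kernel.IsMarkovKernel.map _ (by fun_prop)

/-- One round: the contexts are drawn, the arm is drawn from the policy of the learner at these
contexts, and the reward is drawn. -/
noncomputable def Learner.roundKernel (A : Learner.{u} d K) (B : Instance d K) (t : ℕ) :
    Kernel (A.Seed × History d K t) (Round d K) :=
  ((Kernel.const _ (B.contextLaw t) ⊗ₖ A.policy t) ⊗ₖ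
    (B.rewardKernel t).comap (fun p : (A.Seed × History d K t) × (Contexts d K × Fin K) => p.2)
      measurable_snd).map
    (fun q : (Contexts d K × Fin K) × ℝ => (q.1.1, q.1.2, q.2))

instance (A : Learner.{u} d K) (B : Instance d K) (t : ℕ) :
    IsMarkovKernel (A.roundKernel B t) := by
  unfold Learner.roundKernel
  exact Kernel.IsMarkovKernel.map _ (by fun_prop)

/-- The history after one more round. -/
def History.append {t : ℕ} (h : History d K t) (r : Round d K) : History d K (t + 1) :=
  Fin.snoc (α := fun _ => Round d K) h r

/-- The joint law of the seed and of the first `t` rounds when `A` plays against `B`. -/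
noncomputable def Learner.law (A : Learner.{u} d K) (B : Instance d K) :
    ∀ t : ℕ, Measure (A.Seed × History d K t)
  | 0 => A.seedLaw.map (fun s => (s, Fin.elim0))
  | t + 1 => (A.law B t ⊗ₘ A.roundKernel B t).map
      (fun p => (p.1.1, History.append p.1.2 p.2))

theorem measurable_append_round {S : Type u} [MeasurableSpace S] (t : ℕ) :
    Measurable (fun p : (S × History d K t) × Round d K =>
      (p.1.1, History.append p.1.2 p.2)) := by
  refine (measurable_fst.comp measurable_fst).prodMk ?_
  refine measurable_pi_lambda _ fun i => ?_
  refine Fin.lastCases ?_ (fun j => ?_) i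
  · simp only [History.append, Fin.snoc_last]
    exact measurable_snd
  · simp only [History.append, Fin.snoc_castSucc]
    exact (measurable_pi_apply j).comp (measurable_snd.comp measurable_fst)

instance (A : Learner.{u} d K) (B : Instance d K) (t : ℕ) :
    IsProbabilityMeasure (A.law B t) := by
  induction t with
  | zero =>
    exact Measure.isProbabilityMeasure_map
      (measurable_id.prodMk measurable_const).aemeasurable
  | succ t ih =>
    exact Measure.isProbabilityMeasure_map (measurable_append_round t).aemeasurable

/-- The expected regret over `T` rounds,
`E [∑ₜ (max_i ⟨x_{t,i}, θ⟩ - ⟨x_{t,i_t}, θ⟩)]`. -/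
noncomputable def Learner.expectedRegret (A : Learner.{u} d K) (B : Instance d K) (T : ℕ) : ℝ :=
  ∫ p, ∑ t : Fin T,
    ((⨆ i : Fin K, inner ℝ ((p.2 t).1 i) B.θ) - inner ℝ ((p.2 t).1 (p.2 t).2.1) B.θ)
    ∂(A.law B T)

/-- The policy (a map from contexts to distributions on the arms) that the learner uses in the
round `t` of a run with seed `s` and history `h`. It depends on the rounds before `t` only. -/
noncomputable def Learner.policyAt (A : Learner.{u} d K) {T : ℕ} (s : A.Seed)
    (h : History d K T) (t : Fin T) : Contexts d K → Measure (Fin K) :=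
  fun X => A.policy t ((s, fun i : Fin (t : ℕ) => h (Fin.castLE t.isLt.le i)), X)

/-- There is a policy switch in the first round, and in each later round whose policy differs
from the policy of the round before it. -/
def Learner.IsSwitch (A : Learner.{u} d K) {T : ℕ} (s : A.Seed) (h : History d K T)
    (t : Fin T) : Prop :=
  (t : ℕ) = 0 ∨ ∃ t' : Fin T, (t' : ℕ) + 1 = t ∧ A.policyAt s h t ≠ A.policyAt s h t'

open Classical in
/-- The number of policy switches in the run with seed `s` and history `h`. -/
noncomputable def Learner.numSwitches (A : Learner.{u} d K) {T : ℕ} (s : A.Seed)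
    (h : History d K T) : ℕ :=
  (Finset.univ.filter fun t : Fin T => A.IsSwitch s h t).card

/-- The expected number of policy switches over `T` rounds. The integral is the supremum over
measurable minorants, so an upper bound on it is meaningful (and, if anything, weaker to assume)
even for a learner whose number of switches is not a measurable function. -/
noncomputable def Learner.expectedSwitches (A : Learner.{u} d K) (B : Instance d K) (T : ℕ) :
    ℝ≥0∞ :=
  ∫⁻ p, (A.numSwitches p.1 p.2 : ℝ≥0∞) ∂(A.law B T)

end LinBandit

/-! Write `d = b + 1`. The hidden vector has a known first coordinate `1/2`, and each of the other
`b` coordinates is a number with `m` signed digits in base `1 / r`, at scale `δ`. The horizon is cut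
into `b * m` slots of `N` rounds, one for each digit. In the slot of a digit, one arm has the
context `0`. The context of the other arm uses the known coordinate to subtract the digits already
shown and magnifies the rest, so that its mean reward is about `± g` with the sign of the current
digit.

Two facts make this hard. Before its slot, a digit has only influenced rewards in the earlier slots
of its own coordinate, where its effect is damped geometrically by powers of `r`. If `N * r ^ (2 *
m) ≤ b`, the laws of the past under the two values of the digit have bounded chi-square divergence,
so the policy held at the start of the slot is wrong with probability at least `1/3` on average over
the digits. Unless the policy switches within the slot, the error is repeated `N` times. Summing
over the slots gives regret at least `(g / 2) * N * (b * m / 3 - M)` on some instance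
(`Learner.exists_expectedRegret_ge`, `Learner.exists_expectedRegret_ge_of_digits`).

The choice `r ^ (2 * m) = b ^ 2 * m / T` turns this, for `M ≤ b * m / 4`, into a bound of order `√(T
m b) * (T / (b ^ 2 * m)) ^ (1 / (2 * m))` (`Learner.exists_expectedRegret_ge_of_switches`). The
first claim takes `m` about `8 * M / d`; where `T` is too small for `r ≤ 1/3`, the switch-free bound
`√T / 12` is already enough. The second claim takes `m` of order `log T / log (d log T)`, for which
the extra factor exceeds the allowed power of the logarithm. -/

namespace LinBandit

universe u

/-! ### Chi-square comparison of measures. -/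

section

/-- `μ` is dominated by `ν` in the sense of a Cauchy-Schwarz inequality with constant `c`; this
expresses that the chi-square divergence of `μ` from `ν` is at most `c - 1`. -/
def SqDominated {α : Type*} [MeasurableSpace α] (μ ν : Measure α) (c : ℝ≥0∞) : Prop :=
  ∀ F : α → ℝ≥0∞, Measurable F → (∫⁻ x, F x ∂μ) ^ 2 ≤ c * ∫⁻ x, F x ^ 2 ∂ν

theorem sq_lintegral_mul_le {α : Type*} [MeasurableSpace α] (μ : Measure α) {f g : α → ℝ≥0∞}
    (hf : Measurable f) (hg : Measurable g) :
    (∫⁻ x, f x * g x ∂μ) ^ 2 ≤ (∫⁻ x, f x ^ 2 ∂μ) * ∫⁻ x, g x ^ 2 ∂μ := by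
  have h := ENNReal.lintegral_mul_le_Lp_mul_Lq μ Real.HolderConjugate.two_two
    hf.aemeasurable hg.aemeasurable
  simp only [Pi.mul_apply, ENNReal.rpow_two] at h
  calc _ ≤ _ := pow_le_pow_left' h 2
    _ = _ := by
      rw [mul_pow, ← ENNReal.rpow_two, ← ENNReal.rpow_two, ← ENNReal.rpow_mul, ← ENNReal.rpow_mul]
      norm_num

theorem SqDominated.refl {α : Type*} [MeasurableSpace α] (μ : Measure α)
    [IsProbabilityMeasure μ] : SqDominated μ μ 1 := by
  intro F hF
  simpa [mul_comm] using sq_lintegral_mul_le μ hF (measurable_const (a := (1 : ℝ≥0∞)))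

theorem SqDominated.map {α β : Type*} [MeasurableSpace α] [MeasurableSpace β] {μ ν : Measure α}
    {c : ℝ≥0∞} (h : SqDominated μ ν c) {f : α → β} (hf : Measurable f) :
    SqDominated (μ.map f) (ν.map f) c := by
  intro F hF
  rw [lintegral_map hF hf, lintegral_map (hF.pow_const 2) hf]
  exact h _ (hF.comp hf)

/-- The constants multiply along a composition: apply the outer inequality to the fibre integrals,
then the inner one in each fibre. This tensorization is what lets a whole run be compared round by
round. -/
theorem SqDominated.compProd {α β : Type*} [MeasurableSpace α] [MeasurableSpace β]
    {μ ν : Measure α} [SFinite μ] [SFinite ν] {κ η : Kernel α β} [IsSFiniteKernel κ]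
    [IsSFiniteKernel η] {c c' : ℝ≥0∞} (h : SqDominated μ ν c)
    (h' : ∀ᵐ a ∂ν, SqDominated (κ a) (η a) c') :
    SqDominated (μ ⊗ₘ κ) (ν ⊗ₘ η) (c * c') := by
  intro F hF
  rw [Measure.lintegral_compProd hF, Measure.lintegral_compProd (hF.pow_const 2)]
  refine (h _ hF.lintegral_kernel_prod_right').trans ?_
  rw [mul_assoc]
  gcongr
  rw [← lintegral_const_mul _ (hF.pow_const 2).lintegral_kernel_prod_right']
  refine lintegral_mono_ae ?_
  filter_upwards [h'] with a ha
  exact ha _ (hF.comp measurable_prodMk_left)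

theorem lintegral_gaussianReal_one (m : ℝ) {F : ℝ → ℝ≥0∞} (hF : Measurable F) :
    ∫⁻ x, F x ∂gaussianReal m 1 = ∫⁻ x, gaussianPDF m 1 x * F x := by
  rw [gaussianReal_of_var_ne_zero _ one_ne_zero,
    lintegral_withDensity_eq_lintegral_mul _ (measurable_gaussianPDF _ _) hF]
  rfl

theorem sqDominated_gaussianReal (m m' : ℝ) :
    SqDominated (gaussianReal m 1) (gaussianReal m' 1) (ENNReal.ofReal (Real.exp ((m - m') ^ 2))) := by
  intro F hF
  -- The likelihood ratio of the two Gaussians; its second moment under the second one is the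
  -- constant `exp ((m - m') ^ 2)`.
  let ρ : ℝ → ℝ≥0∞ := fun x =>
    ENNReal.ofReal (Real.exp ((m - m') * (x - m') - (m - m') ^ 2 / 2))
  have hρ : Measurable ρ := by fun_prop
  have h1 : ∀ x, gaussianPDF m 1 x = gaussianPDF m' 1 x * ρ x := by
    intro x
    simp only [gaussianPDF, ρ, gaussianPDFReal]
    rw [← ENNReal.ofReal_mul (by positivity), mul_assoc (_)⁻¹, ← Real.exp_add]
    congr 3
    push_cast
    ring
  have h2 : ∀ x, gaussianPDF m' 1 x * ρ x ^ 2 =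
      ENNReal.ofReal (Real.exp ((m - m') ^ 2)) * gaussianPDF (2 * m - m') 1 x := by
    intro x
    simp only [gaussianPDF, ρ, gaussianPDFReal]
    rw [← ENNReal.ofReal_pow (by positivity), ← ENNReal.ofReal_mul (by positivity),
      ← ENNReal.ofReal_mul (by positivity), ← Real.exp_nat_mul, mul_assoc, ← Real.exp_add,
      mul_left_comm, ← Real.exp_add]
    congr 3
    push_cast
    ring
  have key := sq_lintegral_mul_le (gaussianReal m' 1) hρ hF
  have e1 : ∫⁻ x, ρ x * F x ∂gaussianReal m' 1 = ∫⁻ x, F x ∂gaussianReal m 1 := by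
    rw [lintegral_gaussianReal_one _ (F := fun x => ρ x * F x) (hρ.mul hF), lintegral_gaussianReal_one _ hF]
    refine lintegral_congr fun x => ?_
    rw [h1, mul_assoc]
  have e2 : ∫⁻ x, ρ x ^ 2 ∂gaussianReal m' 1 = ENNReal.ofReal (Real.exp ((m - m') ^ 2)) := by
    rw [lintegral_gaussianReal_one _ (hρ.pow_const 2)]
    simp only [h2]
    rw [lintegral_const_mul _ (measurable_gaussianPDF _ _),
      lintegral_gaussianPDF_eq_one _ one_ne_zero, mul_one]
  rwa [e1, e2] at key

/-- Two mutually close laws cannot be told apart by a test. -/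
theorem SqDominated.test {α : Type*} [MeasurableSpace α] {μ ν : Measure α}
    [IsProbabilityMeasure μ] [IsProbabilityMeasure ν] {c : ℝ} (hc : c ≤ 4 / 3)
    (h : SqDominated μ ν (ENNReal.ofReal c)) {f g : α → ℝ≥0∞} (hf : Measurable f)
    (hfg : ∀ x, f x + g x = 1) :
    2 / 3 ≤ (∫⁻ x, g x ∂μ).toReal + (∫⁻ x, f x ∂ν).toReal := by
  have hf1 : ∀ x, f x ≤ 1 := fun x => (hfg x) ▸ le_self_add
  have hsum : ∫⁻ x, f x ∂μ + ∫⁻ x, g x ∂μ = 1 := by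
    rw [← lintegral_add_left hf]; simp [hfg]
  have hx : ∫⁻ x, f x ∂μ ≠ ∞ := fun h => by simp [h] at hsum
  have hg : ∫⁻ x, g x ∂μ ≠ ∞ := fun h => by simp [h] at hsum
  have ha1 : ∫⁻ x, f x ∂ν ≤ 1 := by
    calc ∫⁻ x, f x ∂ν ≤ ∫⁻ _, 1 ∂ν := lintegral_mono hf1
      _ = 1 := by simp
  have ha : ∫⁻ x, f x ∂ν ≠ ∞ := (ha1.trans_lt ENNReal.one_lt_top).ne
  have h2 : (∫⁻ x, f x ∂μ) ^ 2 ≤ ENNReal.ofReal (4 / 3) * ∫⁻ x, f x ∂ν := by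
    refine (h f hf).trans ?_
    gcongr with x
    rw [sq]
    exact mul_le_of_le_one_left' (hf1 x)
  have h3 := ENNReal.toReal_mono (ENNReal.mul_ne_top ENNReal.ofReal_ne_top ha) h2
  rw [ENNReal.toReal_pow, ENNReal.toReal_mul, ENNReal.toReal_ofReal (by norm_num)] at h3
  have h4 := congrArg ENNReal.toReal hsum
  rw [ENNReal.toReal_add hx hg, ENNReal.toReal_one] at h4
  -- With `x = ∫ f dμ`, the sum is at least `1 - x + 3/4 * x ^ 2 = 2/3 + 3/4 * (x - 2/3) ^ 2`.
  nlinarith [sq_nonneg ((∫⁻ x, f x ∂μ).toReal - 2 / 3)]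

end

/-! ### Laws of runs, and Gaussian instances with deterministic contexts. -/

section

variable {d K : ℕ}

/-- The seed and the first `t` rounds of a run of `T` rounds. -/
def truncRun {S : Type u} {T t : ℕ} (h : t ≤ T) (p : S × History d K T) : S × History d K t :=
  (p.1, fun i => p.2 (Fin.castLE h i))

theorem measurable_truncRun {S : Type u} [MeasurableSpace S] {T t : ℕ} (h : t ≤ T) :
    Measurable (truncRun h : S × History d K T → S × History d K t) := by
  unfold truncRun
  fun_prop

theorem truncRun_append {S : Type u} {t : ℕ} (p : (S × History d K t) × Round d K) :
    truncRun t.le_succ (p.1.1, History.append p.1.2 p.2) = p.1 := by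
  refine Prod.ext rfl (funext fun i => ?_)
  exact Fin.snoc_castSucc (α := fun _ => Round d K) _ _ i

theorem Learner.map_truncRun_law (A : Learner.{u} d K) (B : Instance d K) {T t : ℕ} (h : t ≤ T) :
    (A.law B T).map (truncRun h) = A.law B t := by
  induction T, h using Nat.le_induction with
  | base => exact Measure.map_id
  | succ T h ih =>
    have e : (truncRun (h.trans T.le_succ) :
        A.Seed × History d K (T + 1) → A.Seed × History d K t) =
        truncRun h ∘ truncRun T.le_succ := rfl
    rw [e, ← Measure.map_map (measurable_truncRun _) (measurable_truncRun _)]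
    have : (A.law B (T + 1)).map (truncRun T.le_succ) = A.law B T := by
      rw [Learner.law, Measure.map_map (measurable_truncRun _) (measurable_append_round T)]
      have e' : (truncRun T.le_succ ∘ fun p : (A.Seed × History d K T) × Round d K =>
          (p.1.1, History.append p.1.2 p.2)) = Prod.fst := funext truncRun_append
      rw [e']
      exact Measure.fst_compProd _ _
    rw [this, ih]

theorem Learner.map_round_law (A : Learner.{u} d K) (B : Instance d K) {T t : ℕ} (h : t < T) :
    (A.law B T).map (fun p => (truncRun h.le p, p.2 ⟨t, h⟩)) = A.law B t ⊗ₘ A.roundKernel B t := by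
  have hm : Measurable (fun p : A.Seed × History d K (t + 1) =>
      ((truncRun t.le_succ p : A.Seed × History d K t), p.2 (Fin.last t))) :=
    (measurable_truncRun _).prodMk ((measurable_pi_apply _).comp measurable_snd)
  have e : (fun p : A.Seed × History d K T =>
        ((truncRun h.le p : A.Seed × History d K t), p.2 ⟨t, h⟩)) =
      (fun p : A.Seed × History d K (t + 1) => (truncRun t.le_succ p, p.2 (Fin.last t))) ∘
        truncRun (Nat.succ_le_of_lt h) := rfl
  rw [e, ← Measure.map_map hm (measurable_truncRun _), A.map_truncRun_law, Learner.law,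
    Measure.map_map hm (measurable_append_round t)]
  have e' : ((fun p : A.Seed × History d K (t + 1) =>
        (truncRun t.le_succ p, p.2 (Fin.last t))) ∘
      fun p : (A.Seed × History d K t) × Round d K => (p.1.1, History.append p.1.2 p.2)) = id := by
    refine funext fun p => Prod.ext (truncRun_append p) ?_
    exact Fin.snoc_last (α := fun _ => Round d K) _ _
  rw [e', Measure.map_id]

/-- The instance with hidden vector `θ` and standard Gaussian noise whose contexts in round `t`
are `y t` and `0`. -/
noncomputable def detInstance (θ : EuclideanSpace ℝ (Fin d)) (hθ : ‖θ‖ ≤ 1)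
    (y : ℕ → EuclideanSpace ℝ (Fin d)) (hy : ∀ t, ‖y t‖ ≤ 1) : Instance d 2 where
  θ := θ
  norm_θ_le := hθ
  contextLaw t := Measure.dirac ![y t, 0]
  isProb_contextLaw t := inferInstance
  norm_context_le t := by
    refine (ae_dirac_iff ?_).2 ?_
    · simp only [Set.ofPred_forall]
      exact MeasurableSet.iInter fun i => measurableSet_le (by fun_prop) measurable_const
    · intro i
      fin_cases i
      · exact hy t
      · simp
  noise _ := gaussianReal 0 1
  isProb_noise _ := inferInstance
  noise_subG _ :=
    { integrable_exp_mul := integrable_exp_mul_gaussianReal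
      mgf_le := fun t => by
        rw [mgf_fun_id_gaussianReal]
        simp }

variable {θ θ' : EuclideanSpace ℝ (Fin d)} {hθ : ‖θ‖ ≤ 1} {hθ' : ‖θ'‖ ≤ 1}
  {y y' : ℕ → EuclideanSpace ℝ (Fin d)} {hy : ∀ t, ‖y t‖ ≤ 1} {hy' : ∀ t, ‖y' t‖ ≤ 1}

theorem rewardKernel_detInstance (t : ℕ) (x : Contexts d 2 × Fin 2) :
    (detInstance θ hθ y hy).rewardKernel t x = gaussianReal (inner ℝ (x.1 x.2) θ) 1 := by
  unfold Instance.rewardKernel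
  rw [Kernel.map_apply _ (by fun_prop), Kernel.prod_apply, Kernel.deterministic_apply,
    Kernel.const_apply, Measure.dirac_prod, Measure.map_map (by fun_prop) (by fun_prop)]
  have := gaussianReal_map_const_add (μ := 0) (v := 1) (inner ℝ (x.1 x.2) θ)
  rw [zero_add] at this
  exact this

theorem ae_fst_const_compProd_dirac {α β γ : Type*} [MeasurableSpace α] [MeasurableSpace β]
    [MeasurableSpace γ] [MeasurableSingletonClass β] (x : β) (η : Kernel (α × β) γ)
    [IsMarkovKernel η] (a : α) :
    ∀ᵐ p ∂((Kernel.const α (Measure.dirac x) ⊗ₖ η) a), p.1 = x := by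
  have h : ((Kernel.const α (Measure.dirac x) ⊗ₖ η) a).map Prod.fst = Measure.dirac x := by
    rw [← Kernel.map_apply _ measurable_fst, ← Kernel.fst_eq, Kernel.fst_compProd,
      Kernel.const_apply]
  have h2 : ∀ᵐ b ∂(Measure.dirac x), b = x := by simp [ae_dirac_eq]
  rw [← h] at h2
  exact ae_of_ae_map measurable_fst.aemeasurable h2

/-- Contexts and arm have the same law under both instances, so only the reward can tell them apart.
The arm with context `0` carries no information, and the other one shifts the Gaussian mean by
`inner ℝ (y' t) (θ - θ')`; the worse of the two bounds holds whatever is played. -/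
theorem Learner.sqDominated_roundKernel (A : Learner.{u} d 2) {t : ℕ} (hyy : y t = y' t)
    (q : A.Seed × History d 2 t) :
    SqDominated (A.roundKernel (detInstance θ hθ y hy) t q)
      (A.roundKernel (detInstance θ' hθ' y' hy') t q)
      (ENNReal.ofReal (Real.exp (inner ℝ (y' t) (θ - θ') ^ 2))) := by
  unfold Learner.roundKernel
  rw [Kernel.map_apply _ (by fun_prop), Kernel.map_apply _ (by fun_prop)]
  refine SqDominated.map ?_ (by fun_prop)
  rw [Kernel.compProd_apply_eq_compProd_sectR (Kernel.const _ _ ⊗ₖ A.policy t),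
    Kernel.compProd_apply_eq_compProd_sectR (Kernel.const _ _ ⊗ₖ A.policy t),
    ← one_mul (ENNReal.ofReal _)]
  have hc : (detInstance θ hθ y hy).contextLaw t = (detInstance θ' hθ' y' hy').contextLaw t := by
    simp [detInstance, hyy]
  rw [hc]
  have h0 := SqDominated.refl ((Kernel.const (A.Seed × History d 2 t)
    ((detInstance θ' hθ' y' hy').contextLaw t) ⊗ₖ A.policy t) q)
  refine h0.compProd ?_
  filter_upwards [ae_fst_const_compProd_dirac ![y' t, 0] (A.policy t) q] with p hp
  rw [Kernel.sectR_apply, Kernel.sectR_apply, Kernel.comap_apply, Kernel.comap_apply,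
    rewardKernel_detInstance, rewardKernel_detInstance]
  intro F hF
  refine (sqDominated_gaussianReal (inner ℝ (p.1 p.2) θ) (inner ℝ (p.1 p.2) θ') F hF).trans
    (mul_le_mul' (ENNReal.ofReal_le_ofReal (Real.exp_le_exp.2 ?_)) le_rfl)
  rw [← inner_sub_right, hp]
  generalize p.2 = i
  fin_cases i
  · simp
  · simp [sq_nonneg]

theorem Learner.sqDominated_law (A : Learner.{u} d 2) {t : ℕ} (hyy : ∀ s < t, y s = y' s) :
    SqDominated (A.law (detInstance θ hθ y hy) t) (A.law (detInstance θ' hθ' y' hy') t)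
      (ENNReal.ofReal (Real.exp (∑ s ∈ Finset.range t, inner ℝ (y' s) (θ - θ') ^ 2))) := by
  induction t with
  | zero =>
    rw [Finset.sum_range_zero, Real.exp_zero, ENNReal.ofReal_one]
    exact SqDominated.refl (A.law (detInstance θ' hθ' y' hy') 0)
  | succ t ih =>
    rw [Learner.law, Learner.law, Finset.sum_range_succ, Real.exp_add,
      ENNReal.ofReal_mul (Real.exp_nonneg _)]
    refine ((ih fun s hs => hyy s (hs.trans t.lt_succ_self)).compProd ?_).map
      (measurable_append_round t)
    exact ae_of_all _ fun q => A.sqDominated_roundKernel (hyy t t.lt_succ_self) q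

theorem Learner.map_roundKernel (A : Learner.{u} d K) (B : Instance d K) (t : ℕ)
    (q : A.Seed × History d K t) :
    (A.roundKernel B t q).map (fun r => (r.1, r.2.1)) =
      (Kernel.const _ (B.contextLaw t) ⊗ₖ A.policy t) q := by
  unfold Learner.roundKernel
  rw [Kernel.map_apply _ (by fun_prop), Measure.map_map (by fun_prop) (by fun_prop)]
  change Measure.map Prod.fst _ = _
  rw [← Kernel.map_apply _ measurable_fst, ← Kernel.fst_eq, Kernel.fst_compProd]

theorem Learner.ae_context (A : Learner.{u} d 2) {T t : ℕ} (ht : t < T) :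
    ∀ᵐ p ∂(A.law (detInstance θ hθ y hy) T), (p.2 ⟨t, ht⟩).1 = ![y t, 0] := by
  have h : ∀ᵐ p ∂(A.law (detInstance θ hθ y hy) t ⊗ₘ A.roundKernel (detInstance θ hθ y hy) t),
      p.2.1 = ![y t, 0] := by
    refine (Measure.ae_compProd_iff ?_).2 (ae_of_all _ fun q => ?_)
    · exact (measurable_fst.comp measurable_snd) (measurableSet_singleton _)
    · have h := ae_fst_const_compProd_dirac ![y t, 0] (A.policy t) q
      have h' := A.map_roundKernel (detInstance θ hθ y hy) t q
      change _ = (Kernel.const _ (Measure.dirac ![y t, 0]) ⊗ₖ A.policy t) q at h'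
      rw [← h'] at h
      exact ae_of_ae_map (by fun_prop) h
  rw [← A.map_round_law _ ht] at h
  exact ae_of_ae_map ((measurable_truncRun _).prodMk (by fun_prop)).aemeasurable h

/-- The probability that the learner plays the arm `i` in round `t` at the contexts `X`, as a
function of the run. -/
noncomputable def Learner.armProb (A : Learner.{u} d K) {T t : ℕ} (ht : t ≤ T) (X : Contexts d K)
    (i : Fin K) (p : A.Seed × History d K T) : ℝ≥0∞ :=
  A.policy t (truncRun ht p, X) {i}

theorem Learner.measurable_armProb (A : Learner.{u} d K) {T t : ℕ} (ht : t ≤ T)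
    (X : Contexts d K) (i : Fin K) : Measurable (A.armProb (T := T) ht X i) :=
  ((A.policy t).measurable_coe (measurableSet_singleton i)).comp
    ((measurable_truncRun ht).prodMk measurable_const)

/-- Replaces the arm actually played by its conditional probability given the past, which stays
constant as long as the policy does not change. -/
theorem Learner.law_arm_eq (A : Learner.{u} d 2) {T t : ℕ} (ht : t < T) (i : Fin 2) :
    A.law (detInstance θ hθ y hy) T {p | (p.2 ⟨t, ht⟩).2.1 = i} =
      ∫⁻ p, A.armProb ht.le ![y t, 0] i p ∂(A.law (detInstance θ hθ y hy) T) := by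
  have hs : MeasurableSet {p : (A.Seed × History d 2 t) × Round d 2 | p.2.2.1 = i} :=
    (by fun_prop : Measurable fun p : (A.Seed × History d 2 t) × Round d 2 => p.2.2.1)
      (measurableSet_singleton i)
  have hm : Measurable (fun p : A.Seed × History d 2 T =>
      ((truncRun ht.le p : A.Seed × History d 2 t), p.2 ⟨t, ht⟩)) :=
    (measurable_truncRun _).prodMk (by fun_prop)
  have h1 := congrArg (fun μ => μ {p | p.2.2.1 = i}) (A.map_round_law (detInstance θ hθ y hy) ht)
  rw [Measure.map_apply hm hs, Measure.compProd_apply hs] at h1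
  refine h1.trans ?_
  have h2 : ∀ q : A.Seed × History d 2 t,
      A.roundKernel (detInstance θ hθ y hy) t q (Prod.mk q ⁻¹' {p | p.2.2.1 = i}) =
        A.policy t (q, ![y t, 0]) {i} := by
    intro q
    have h := congrArg (fun μ => μ (Prod.snd ⁻¹' {i})) (A.map_roundKernel (detInstance θ hθ y hy) t q)
    have hs' : MeasurableSet (Prod.snd ⁻¹' {i} : Set (Contexts d 2 × Fin 2)) :=
      measurable_snd (measurableSet_singleton i)
    rw [Measure.map_apply (by fun_prop) hs', Kernel.compProd_apply hs'] at h
    refine h.trans ?_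
    change ∫⁻ b, A.policy t (q, b) {i} ∂(Measure.dirac ![y t, 0]) = _
    exact lintegral_dirac' (f := fun b => A.policy t (q, b) {i}) _
      (((A.policy t).measurable_coe (measurableSet_singleton i)).comp measurable_prodMk_left)
  rw [lintegral_congr h2]
  rw [← A.map_truncRun_law _ ht.le, lintegral_map _ (measurable_truncRun _)]
  · rfl
  · exact ((A.policy t).measurable_coe (measurableSet_singleton i)).comp
      (measurable_id.prodMk measurable_const)

end

/-! ### Regret and switches, slot by slot. -/

section

variable {d : ℕ} {θ θ' : EuclideanSpace ℝ (Fin d)} {hθ : ‖θ‖ ≤ 1} {hθ' : ‖θ'‖ ≤ 1}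
  {y y' : ℕ → EuclideanSpace ℝ (Fin d)} {hy : ∀ t, ‖y t‖ ≤ 1} {hy' : ∀ t, ‖y' t‖ ≤ 1}

/-- The regret of a round whose two arms have the expected rewards `m` and `0`. -/
noncomputable def armRegret (m : ℝ) (i : Fin 2) : ℝ := max m 0 - if i = 0 then m else 0

theorem armRegret_nonneg (m : ℝ) (i : Fin 2) : 0 ≤ armRegret m i := by
  unfold armRegret
  split_ifs <;> simp

theorem le_armRegret {m w : ℝ} {i : Fin 2} (h : w ≤ if i = 1 then m else -m) :
    w ≤ armRegret m i := by
  unfold armRegret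
  fin_cases i
  · simp at h ⊢
    linarith [le_max_right m 0]
  · simp at h ⊢
    exact Or.inl h

theorem iSup_sub_eq_armRegret (θ y : EuclideanSpace ℝ (Fin d)) {X : Contexts d 2}
    (hX : X = ![y, 0]) (i : Fin 2) :
    (⨆ j : Fin 2, inner ℝ (X j) θ) - inner ℝ (X i) θ = armRegret (inner ℝ y θ) i := by
  have h : (⨆ j : Fin 2, inner ℝ (X j) θ) = max (inner ℝ y θ) 0 := by
    subst hX
    refine le_antisymm (ciSup_le fun j => ?_) (max_le ?_ ?_)
    · fin_cases j <;> simp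
    · exact le_ciSup (f := fun j => inner ℝ ((![y, 0] : Contexts d 2) j) θ)
        (Set.finite_range _).bddAbove 0
    · have := le_ciSup (f := fun j => inner ℝ ((![y, 0] : Contexts d 2) j) θ)
        (Set.finite_range _).bddAbove 1
      simpa using this
  rw [h, armRegret]
  subst hX
  fin_cases i <;> simp

/-- Rounds outside the range of `τ` may be dropped, since no round has negative regret. Here `bad k`
is the inferior arm of round `τ k`: the zero arm `1` if the mean of `y` is positive, the arm `0` if
it is negative. -/
theorem Learner.sum_le_expectedRegret (A : Learner.{u} d 2) {T : ℕ} {ι : Type*} [Fintype ι]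
    (τ : ι ↪ Fin T) (bad : ι → Fin 2) (w : ι → ℝ)
    (h : ∀ k, w k ≤ if bad k = 1 then inner ℝ (y (τ k)) θ else -inner ℝ (y (τ k)) θ) :
    ∑ k, w k * (∫⁻ p, A.armProb (τ k).isLt.le ![y (τ k), 0] (bad k) p
      ∂(A.law (detInstance θ hθ y hy) T)).toReal ≤
        A.expectedRegret (detInstance θ hθ y hy) T := by
  set P := A.law (detInstance θ hθ y hy) T with hP
  have hint : ∀ (t : Fin T) (g : Fin 2 → ℝ), Integrable (fun p => g (p.2 t).2.1) P := by
    intro t g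
    exact Integrable.comp_measurable (f := fun p : A.Seed × History d 2 T => (p.2 t).2.1)
      (Integrable.of_finite (f := g)) (by fun_prop)
  have e1 : A.expectedRegret (detInstance θ hθ y hy) T =
      ∫ p, ∑ t : Fin T, armRegret (inner ℝ (y t) θ) (p.2 t).2.1 ∂P := by
    refine integral_congr_ae ?_
    have hall : ∀ᵐ p ∂P, ∀ t : Fin T, (p.2 t).1 = ![y t, 0] :=
      ae_all_iff.2 fun t => A.ae_context t.isLt
    filter_upwards [hall] with p hp
    exact Finset.sum_congr rfl fun t _ => iSup_sub_eq_armRegret θ (y t) (hp t) _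
  have e2 : ∑ k, w k * (∫⁻ p, A.armProb (τ k).isLt.le ![y (τ k), 0] (bad k) p ∂P).toReal =
      ∫ p, ∑ k, (if (p.2 (τ k)).2.1 = bad k then w k else 0) ∂P := by
    rw [integral_finsetSum _ fun k _ => hint (τ k) fun i => if i = bad k then w k else 0]
    refine Finset.sum_congr rfl fun k _ => ?_
    rw [← A.law_arm_eq (τ k).isLt (bad k)]
    have hs : MeasurableSet {p : A.Seed × History d 2 T | (p.2 (τ k)).2.1 = bad k} :=
      (by fun_prop : Measurable fun p : A.Seed × History d 2 T => (p.2 (τ k)).2.1)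
        (measurableSet_singleton (bad k))
    have := integral_indicator_const (μ := P) (w k) hs
    rw [smul_eq_mul, mul_comm, measureReal_def] at this
    rw [← this]
    exact integral_congr_ae (ae_of_all _ fun p => by simp [Set.indicator_apply])
  rw [e1, e2]
  refine integral_mono
    (integrable_finsetSum _ fun k _ => hint (τ k) fun i => if i = bad k then w k else 0)
    (integrable_finsetSum _ fun t _ => hint t _) fun p => ?_
  calc _ ≤ ∑ k, armRegret (inner ℝ (y (τ k)) θ) (p.2 (τ k)).2.1 := by
        refine Finset.sum_le_sum fun k _ => ?_
        split_ifs with hk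
        · rw [hk]
          exact le_armRegret (h k)
        · exact armRegret_nonneg _ _
    _ = ∑ t ∈ Finset.univ.map τ, armRegret (inner ℝ (y t) θ) (p.2 t).2.1 := by
        rw [Finset.sum_map]
    _ ≤ _ := Finset.sum_le_univ_sum_of_nonneg fun t => armRegret_nonneg _ _

/-- The `j`-th round of the `l`-th of `n` consecutive slots of `N` rounds each. -/
def slotRound {T n N : ℕ} (hT : n * N ≤ T) : Fin n × Fin N ↪ Fin T :=
  finProdFinEquiv.toEmbedding.trans (Fin.castLEEmb hT)

theorem slotRound_val {T n N : ℕ} (hT : n * N ≤ T) (q : Fin n × Fin N) :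
    (slotRound hT q : ℕ) = q.2 + N * q.1 := rfl

variable {K : ℕ}

/-- The runs in which, during the slot `l`, the learner changes the probability with which it plays
the arm `i` at the contexts `X`. -/
def Learner.slotSwitch (A : Learner.{u} d K) {T n N : ℕ} [NeZero N] (hT : n * N ≤ T)
    (X : Contexts d K) (i : Fin K) (l : Fin n) : Set (A.Seed × History d K T) :=
  {p | ∃ j : Fin N, A.armProb (slotRound hT (l, j)).isLt.le X i p ≠
    A.armProb (slotRound hT (l, 0)).isLt.le X i p}

theorem Learner.measurableSet_slotSwitch (A : Learner.{u} d K) {T n N : ℕ} [NeZero N]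
    (hT : n * N ≤ T) (X : Contexts d K) (i : Fin K) (l : Fin n) :
    MeasurableSet (A.slotSwitch hT X i l) := by
  have : A.slotSwitch hT X i l = ⋃ j : Fin N,
      {p | A.armProb (slotRound hT (l, j)).isLt.le X i p =
        A.armProb (slotRound hT (l, 0)).isLt.le X i p}ᶜ := by
    ext p
    simp [Learner.slotSwitch]
  rw [this]
  exact MeasurableSet.iUnion fun j =>
    (measurableSet_eq_fun (A.measurable_armProb _ X i) (A.measurable_armProb _ X i)).compl

theorem Learner.exists_isSwitch (A : Learner.{u} d K) {T n N : ℕ} [NeZero N]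
    (hT : n * N ≤ T) {X : Contexts d K} {i : Fin K} {l : Fin n} {p : A.Seed × History d K T}
    (hp : p ∈ A.slotSwitch hT X i l) : ∃ j : Fin N, A.IsSwitch p.1 p.2 (slotRound hT (l, j)) := by
  by_contra! hno
  obtain ⟨j, hj⟩ := hp
  have key : ∀ (m : ℕ) (hm : m < N), A.policyAt p.1 p.2 (slotRound hT (l, ⟨m, hm⟩)) =
      A.policyAt p.1 p.2 (slotRound hT (l, 0)) := by
    intro m
    induction m with
    | zero => intro _; rfl
    | succ m ih =>
      intro hm
      rw [← ih (m.lt_succ_self.trans hm)]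
      by_contra hne
      exact hno ⟨m + 1, hm⟩ (Or.inr ⟨slotRound hT (l, ⟨m, m.lt_succ_self.trans hm⟩),
        by simp only [slotRound_val]; omega, hne⟩)
  exact hj (congrArg (fun χ => χ X {i}) (key j j.isLt))

/-- Each slot in which the arm probability changes contains a switch, and the slots are disjoint, so
these switches are distinct. The events used are measurable even when `numSwitches` is not. -/
theorem Learner.sum_slotSwitch_le (A : Learner.{u} d K) (B : Instance d K) {T n N : ℕ} [NeZero N]
    (hT : n * N ≤ T) (X : Fin n → Contexts d K) (i : Fin n → Fin K) :
    ∑ l, A.law B T (A.slotSwitch hT (X l) (i l) l) ≤ A.expectedSwitches B T := by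
  classical
  have e : ∑ l, A.law B T (A.slotSwitch hT (X l) (i l) l) =
      ∫⁻ p, ∑ l, (A.slotSwitch hT (X l) (i l) l).indicator 1 p ∂(A.law B T) := by
    rw [lintegral_finsetSum _ fun l _ =>
      measurable_one.indicator (A.measurableSet_slotSwitch hT _ _ l)]
    exact Finset.sum_congr rfl fun l _ =>
      (lintegral_indicator_one (A.measurableSet_slotSwitch hT _ _ l)).symm
  rw [e]
  refine lintegral_mono fun p => ?_
  have e' : ∑ l, (A.slotSwitch hT (X l) (i l) l).indicator (1 : A.Seed × History d K T → ℝ≥0∞) p =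
      ((Finset.univ.filter fun l => p ∈ A.slotSwitch hT (X l) (i l) l).card : ℝ≥0∞) := by
    simp [Set.indicator_apply]
  simp only
  rw [e', Learner.numSwitches]
  refine Nat.cast_le.2 ?_
  have hex : ∀ l, ∃ j : Fin N, p ∈ A.slotSwitch hT (X l) (i l) l →
      A.IsSwitch p.1 p.2 (slotRound hT (l, j)) := fun l => by
    by_cases h : p ∈ A.slotSwitch hT (X l) (i l) l
    · exact (A.exists_isSwitch hT h).imp fun _ hj _ => hj
    · exact ⟨0, fun h' => absurd h' h⟩
  choose j hj using hex
  refine Finset.card_le_card_of_injOn (fun l => slotRound hT (l, j l)) (fun l hl => ?_) ?_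
  · simp only [Finset.coe_filter, Finset.mem_univ, true_and, Set.mem_ofPred_eq] at hl ⊢
    exact hj l hl
  · intro l _ l' _ hll
    exact congrArg Prod.fst ((slotRound hT).injective hll)

end

/-! ### Indistinguishable instances force errors that persist through a slot. -/

section

variable {d K : ℕ}

theorem Learner.lintegral_armProb (A : Learner.{u} d K) (B : Instance d K) {T t : ℕ} (ht : t ≤ T)
    (X : Contexts d K) (i : Fin K) :
    ∫⁻ p, A.armProb ht X i p ∂(A.law B T) = ∫⁻ p, A.armProb le_rfl X i p ∂(A.law B t) := by
  rw [← A.map_truncRun_law B ht, lintegral_map (A.measurable_armProb _ _ _) (measurable_truncRun _)]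
  rfl

theorem Learner.armProb_le_one (A : Learner.{u} d K) {T t : ℕ} (ht : t ≤ T) (X : Contexts d K)
    (i : Fin K) (p : A.Seed × History d K T) : A.armProb ht X i p ≤ 1 :=
  prob_le_one

theorem Learner.armProb_add (A : Learner.{u} d 2) {T t : ℕ} (ht : t ≤ T) (X : Contexts d 2)
    {i j : Fin 2} (hij : j ≠ i) (p : A.Seed × History d 2 T) :
    A.armProb ht X i p + A.armProb ht X j p = 1 := by
  unfold Learner.armProb
  rw [← measure_union (by simpa using hij.symm) (measurableSet_singleton j)]
  have : ({i} ∪ {j} : Set (Fin 2)) = Set.univ := by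
    ext k
    simp only [Set.mem_union, Set.mem_singleton_iff, Set.mem_univ, iff_true]
    omega
  rw [this, measure_univ]

theorem Learner.lintegral_armProb_ne_top (A : Learner.{u} d K) (B : Instance d K) {T t : ℕ}
    (ht : t ≤ T) (X : Contexts d K) (i : Fin K) :
    ∫⁻ p, A.armProb ht X i p ∂(A.law B T) ≠ ∞ := by
  refine ((lintegral_mono (A.armProb_le_one ht X i)).trans_lt ?_).ne
  simp

/-- The policy of round `t` is a function of the first `t` rounds only, so it acts as a randomized
test between the two truncated laws. -/
theorem Learner.error_add_error_ge (A : Learner.{u} d 2) {T t : ℕ} (ht : t ≤ T)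
    {θ θ' : EuclideanSpace ℝ (Fin d)} {hθ : ‖θ‖ ≤ 1} {hθ' : ‖θ'‖ ≤ 1}
    {y y' : ℕ → EuclideanSpace ℝ (Fin d)} {hy : ∀ t, ‖y t‖ ≤ 1} {hy' : ∀ t, ‖y' t‖ ≤ 1}
    (hyy : ∀ s < t, y s = y' s)
    (hS : Real.exp (∑ s ∈ Finset.range t, inner ℝ (y' s) (θ - θ') ^ 2) ≤ 4 / 3)
    (X : Contexts d 2) {i j : Fin 2} (hij : j ≠ i) :
    2 / 3 ≤ (∫⁻ p, A.armProb ht X j p ∂(A.law (detInstance θ hθ y hy) T)).toReal +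
      (∫⁻ p, A.armProb ht X i p ∂(A.law (detInstance θ' hθ' y' hy') T)).toReal := by
  rw [A.lintegral_armProb _ ht, A.lintegral_armProb _ ht]
  exact (A.sqDominated_law hyy).test hS (A.measurable_armProb _ _ _) (A.armProb_add _ X hij)

theorem Learner.armProb_le_add_slotSwitch (A : Learner.{u} d K) (B : Instance d K) {T n N : ℕ}
    [NeZero N] (hT : n * N ≤ T) (X : Contexts d K) (i : Fin K) (l : Fin n) (j : Fin N) :
    (∫⁻ p, A.armProb (slotRound hT (l, 0)).isLt.le X i p ∂(A.law B T)).toReal ≤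
      (∫⁻ p, A.armProb (slotRound hT (l, j)).isLt.le X i p ∂(A.law B T)).toReal +
        (A.law B T).real (A.slotSwitch hT X i l) := by
  rw [measureReal_def, ← ENNReal.toReal_add (A.lintegral_armProb_ne_top _ _ _ _)
    (measure_ne_top _ _)]
  refine ENNReal.toReal_mono (ENNReal.add_ne_top.2
    ⟨A.lintegral_armProb_ne_top _ _ _ _, measure_ne_top _ _⟩) ?_
  rw [← lintegral_indicator_one (A.measurableSet_slotSwitch hT X i l),
    ← lintegral_add_left (A.measurable_armProb _ _ _)]
  refine lintegral_mono fun p => ?_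
  by_cases hp : p ∈ A.slotSwitch hT X i l
  · rw [Set.indicator_of_mem hp]
    exact (A.armProb_le_one _ X i p).trans le_add_self
  · rw [Set.indicator_of_notMem hp, add_zero]
    simp only [Learner.slotSwitch, Set.mem_ofPred_eq, not_exists, not_not] at hp
    exact (hp j).ge

/-- Averaging over a finite family of instances whose members cannot be told apart, before a slot
begins, from a member with the opposite best arm in the slot. -/
theorem Learner.exists_expectedRegret_ge (A : Learner.{u} d 2) {T n N : ℕ} [NeZero N]
    (hT : n * N ≤ T) {Ω : Type*} [Fintype Ω] [Nonempty Ω] (θ : Ω → EuclideanSpace ℝ (Fin d))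
    (hθ : ∀ σ, ‖θ σ‖ ≤ 1) (y : Ω → ℕ → EuclideanSpace ℝ (Fin d)) (hy : ∀ σ t, ‖y σ t‖ ≤ 1)
    (flip : Fin n → Equiv.Perm Ω) (bad : Ω → Fin n → Fin 2) {w M : ℝ} (hw : 0 ≤ w)
    (hbad : ∀ σ l, bad (flip l σ) l ≠ bad σ l)
    (hflip : ∀ σ (l : Fin n), ∀ s ≤ N * l, y (flip l σ) s = y σ s)
    (hslot : ∀ σ (l : Fin n) (j : Fin N), y σ (j + N * l) = y σ (N * l))
    (hinfo : ∀ σ (l : Fin n), Real.exp (∑ s ∈ Finset.range (N * l),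
      inner ℝ (y σ s) (θ (flip l σ) - θ σ) ^ 2) ≤ 4 / 3)
    (hgap : ∀ σ (l : Fin n), w ≤ if bad σ l = 1 then inner ℝ (y σ (N * l)) (θ σ)
      else -inner ℝ (y σ (N * l)) (θ σ))
    (hsw : ∀ σ, ∑ l : Fin n, (A.law (detInstance (θ σ) (hθ σ) (y σ) (hy σ)) T).real
      (A.slotSwitch hT ![y σ (N * l), 0] (bad σ l) l) ≤ M) :
    ∃ σ, w * N * (n / 3 - M) ≤
      A.expectedRegret (detInstance (θ σ) (hθ σ) (y σ) (hy σ)) T := by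
  set P := fun σ => A.law (detInstance (θ σ) (hθ σ) (y σ) (hy σ)) T with hP
  set Q : Ω → Fin n → ℝ := fun σ l =>
    (∫⁻ p, A.armProb (slotRound hT (l, 0)).isLt.le ![y σ (N * l), 0] (bad σ l) p ∂(P σ)).toReal
    with hQ
  have hval : ∀ (l : Fin n) (j : Fin N), ((slotRound hT (l, j) : Fin T) : ℕ) = j + N * l :=
    fun l j => slotRound_val hT (l, j)
  have hreg : ∀ σ, w * N * (∑ l, Q σ l - M) ≤
      A.expectedRegret (detInstance (θ σ) (hθ σ) (y σ) (hy σ)) T := by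
    intro σ
    have hyv : ∀ l j, y σ (slotRound hT (l, j) : Fin T) = y σ (N * l) :=
      fun l j => by rw [hval, hslot]
    refine le_trans ?_ (A.sum_le_expectedRegret (slotRound hT) (fun q => bad σ q.1) (fun _ => w)
      fun q => ?_)
    · calc w * N * (∑ l, Q σ l - M)
          ≤ w * N * (∑ l, Q σ l - ∑ l : Fin n, (P σ).real
              (A.slotSwitch hT ![y σ (N * l), 0] (bad σ l) l)) := by
            gcongr
            exact hsw σ
        _ = ∑ l : Fin n, ∑ j : Fin N, w * (Q σ l - (P σ).real
              (A.slotSwitch hT ![y σ (N * l), 0] (bad σ l) l)) := by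
            simp only [Finset.sum_const, Finset.card_univ, Fintype.card_fin, nsmul_eq_mul]
            rw [← Finset.sum_sub_distrib, Finset.mul_sum]
            exact Finset.sum_congr rfl fun l _ => by ring
        _ ≤ ∑ l : Fin n, ∑ j : Fin N, w * (∫⁻ p, A.armProb (slotRound hT (l, j)).isLt.le
              ![y σ (slotRound hT (l, j)), 0] (bad σ l) p ∂(P σ)).toReal := by
            refine Finset.sum_le_sum fun l _ => Finset.sum_le_sum fun j _ => ?_
            rw [hyv]
            refine mul_le_mul_of_nonneg_left ?_ hw
            rw [sub_le_iff_le_add]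
            exact A.armProb_le_add_slotSwitch _ hT _ _ l j
        _ = _ := by rw [Fintype.sum_prod_type]
    · rw [hyv]
      exact hgap σ q.1
  -- The instances `σ` and `flip l σ` show the same context in slot `l` but have opposite bad arms
  -- there.
  have hpair : ∀ l σ, 2 / 3 ≤ Q (flip l σ) l + Q σ l := by
    intro l σ
    have hv : ((slotRound hT (l, 0) : Fin T) : ℕ) = N * l := by simp [hval]
    have hs : ∀ s < ((slotRound hT (l, 0) : Fin T) : ℕ), y (flip l σ) s = y σ s :=
      fun s hs => hflip σ l s (hv ▸ hs).le
    have := A.error_add_error_ge (slotRound hT (l, 0)).isLt.le (hθ := hθ (flip l σ)) (hθ' := hθ σ)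
      (hy := hy (flip l σ)) (hy' := hy σ) hs (by rw [hv]; exact hinfo σ l) ![y σ (N * l), 0]
      (hbad σ l)
    simp only [hQ, hP]
    rwa [hflip σ l _ le_rfl]
  -- As `flip l` permutes the family, summing the pair inequality counts every `Q σ l` twice.
  have hcol : ∀ l, (Fintype.card Ω : ℝ) * (1 / 3) ≤ ∑ σ, Q σ l := by
    intro l
    have h1 : ∑ σ, Q (flip l σ) l = ∑ σ, Q σ l := Equiv.sum_comp (flip l) fun σ => Q σ l
    have h2 : ∑ _σ : Ω, (2 / 3 : ℝ) ≤ ∑ σ, (Q (flip l σ) l + Q σ l) :=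
      Finset.sum_le_sum fun σ _ => hpair l σ
    rw [Finset.sum_add_distrib, h1, Finset.sum_const, Finset.card_univ, nsmul_eq_mul] at h2
    linarith
  have hsum : (Fintype.card Ω : ℝ) * (n / 3) ≤ ∑ σ, ∑ l, Q σ l := by
    rw [Finset.sum_comm]
    calc (Fintype.card Ω : ℝ) * (n / 3) = ∑ _l : Fin n, (Fintype.card Ω : ℝ) * (1 / 3) := by
          rw [Finset.sum_const, Finset.card_univ, Fintype.card_fin, nsmul_eq_mul]
          ring
      _ ≤ _ := Finset.sum_le_sum fun l _ => hcol l
  obtain ⟨σ, -, hσ⟩ := Finset.exists_le_of_sum_le (s := Finset.univ)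
    (f := fun _ : Ω => (n / 3 : ℝ)) (g := fun σ => ∑ l, Q σ l) Finset.univ_nonempty (by
      simpa [Finset.sum_const, nsmul_eq_mul] using hsum)
  refine ⟨σ, le_trans ?_ (hreg σ)⟩
  gcongr

end

/-! ### Signed-digit numbers and the vectors that encode them. -/

section

theorem sum_range_mul_div {N : ℕ} (hN : 0 < N) (f : ℕ → ℝ) (l : ℕ) :
    ∑ s ∈ Finset.range (N * l), f (s / N) = N * ∑ k ∈ Finset.range l, f k := by
  induction l with
  | zero => simp
  | succ l ih =>
    rw [Nat.mul_succ, Finset.sum_range_add, ih, Finset.sum_range_succ, mul_add]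
    congr 1
    rw [Finset.sum_congr rfl (g := fun _ => f l) fun s hs => ?_]
    · simp
    · rw [Nat.mul_add_div hN, Nat.div_eq_of_lt (Finset.mem_range.1 hs), add_zero]

theorem sum_range_pow_sub_le {x : ℝ} (h0 : 0 ≤ x) (h1 : x ≤ 1 / 9) (l : ℕ) :
    ∑ k ∈ Finset.range l, x ^ (l - k) ≤ 9 / 8 * x := by
  induction l with
  | zero => simpa using h0
  | succ l ih =>
    have h : ∑ k ∈ Finset.range l, x ^ (l + 1 - k) = x * ∑ k ∈ Finset.range l, x ^ (l - k) := by
      rw [Finset.mul_sum]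
      refine Finset.sum_congr rfl fun k hk => ?_
      rw [Nat.succ_sub (Finset.mem_range.1 hk).le, pow_succ, mul_comm]
    rw [Finset.sum_range_succ, h, Nat.add_sub_cancel_left, pow_one]
    nlinarith

theorem sum_fin_lt_pow_le {r : ℝ} (h0 : 0 ≤ r) (h1 : r ≤ 1 / 3) (m k : ℕ) :
    ∑ j : Fin m, (if k < (j : ℕ) then r ^ (j : ℕ) else 0) ≤ r ^ k / 2 := by
  rw [Fin.sum_univ_eq_sum_range (fun j => if k < j then r ^ j else 0) m, ← Finset.sum_filter]
  have hsub : (Finset.range m).filter (fun j => k < j) ⊆ Finset.Ico (k + 1) m := by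
    intro j hj
    simp only [Finset.mem_filter, Finset.mem_range, Finset.mem_Ico] at hj ⊢
    omega
  calc _ ≤ ∑ j ∈ Finset.Ico (k + 1) m, r ^ j :=
        Finset.sum_le_sum_of_subset_of_nonneg hsub fun _ _ _ => by positivity
    _ ≤ r ^ (k + 1) / (1 - r) := geom_sum_Ico_le_of_lt_one h0 (by linarith)
    _ ≤ r ^ k / 2 := by
        rw [div_le_div_iff₀ (by linarith) two_pos, pow_succ]
        nlinarith [pow_nonneg h0 k]

theorem sum_fin_pow_le {r : ℝ} (h0 : 0 ≤ r) (h1 : r ≤ 1 / 3) (m : ℕ) :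
    ∑ j : Fin m, r ^ (j : ℕ) ≤ 3 / 2 := by
  rw [Fin.sum_univ_eq_sum_range (fun j => r ^ j) m, Finset.range_eq_Ico]
  refine (geom_sum_Ico_le_of_lt_one h0 (by linarith)).trans ?_
  rw [pow_zero, div_le_div_iff₀ (by linarith) two_pos]
  linarith

/-- The sign that a bit encodes. -/
def bitSign (c : Bool) : ℝ := if c then 1 else -1

theorem abs_bitSign (c : Bool) : |bitSign c| = 1 := by cases c <;> simp [bitSign]

variable {b m : ℕ}

/-- The number with the signed digits `τ` in base `1 / r`, at the scale `δ`. -/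
noncomputable def digitSum (δ r : ℝ) (τ : Fin m → Bool) : ℝ :=
  ∑ j, bitSign (τ j) * (δ * r ^ (j : ℕ))

/-- The part of `digitSum` that the digits before the `k`-th one contribute. -/
noncomputable def digitPrefix (δ r : ℝ) (τ : Fin m → Bool) (k : Fin m) : ℝ :=
  ∑ j, if j < k then bitSign (τ j) * (δ * r ^ (j : ℕ)) else 0

theorem abs_digitSum_le {δ r : ℝ} (hδ : 0 ≤ δ) (h0 : 0 ≤ r) (h1 : r ≤ 1 / 3) (τ : Fin m → Bool) :
    |digitSum δ r τ| ≤ 3 / 2 * δ := by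
  calc _ ≤ ∑ j, |bitSign (τ j) * (δ * r ^ (j : ℕ))| := Finset.abs_sum_le_sum_abs _ _
    _ = δ * ∑ j : Fin m, r ^ (j : ℕ) := by
        rw [Finset.mul_sum]
        refine Finset.sum_congr rfl fun j _ => ?_
        rw [abs_mul, abs_bitSign, one_mul, abs_of_nonneg (by positivity)]
    _ ≤ _ := by nlinarith [sum_fin_pow_le h0 h1 m]

theorem abs_digitPrefix_le {δ r : ℝ} (hδ : 0 ≤ δ) (h0 : 0 ≤ r) (h1 : r ≤ 1 / 3)
    (τ : Fin m → Bool) (k : Fin m) : |digitPrefix δ r τ k| ≤ 3 / 2 * δ := by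
  calc _ ≤ ∑ j, |if j < k then bitSign (τ j) * (δ * r ^ (j : ℕ)) else 0| :=
        Finset.abs_sum_le_sum_abs _ _
    _ ≤ ∑ j : Fin m, δ * r ^ (j : ℕ) := by
        refine Finset.sum_le_sum fun j _ => ?_
        split_ifs
        · rw [abs_mul, abs_bitSign, one_mul, abs_of_nonneg (by positivity)]
        · rw [abs_zero]
          positivity
    _ ≤ _ := by
        rw [← Finset.mul_sum]
        nlinarith [sum_fin_pow_le h0 h1 m]

/-- For `r ≤ 1/3` the later digits amount to at most half of the current one, so the current digit
decides the sign of the remainder and leaves a gap of half its size. -/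
theorem abs_digitSum_sub_digitPrefix_sub_le {δ r : ℝ} (hδ : 0 ≤ δ) (h0 : 0 ≤ r) (h1 : r ≤ 1 / 3)
    (τ : Fin m → Bool) (k : Fin m) :
    |digitSum δ r τ - digitPrefix δ r τ k - bitSign (τ k) * (δ * r ^ (k : ℕ))| ≤
      δ * r ^ (k : ℕ) / 2 := by
  have e : digitSum δ r τ - digitPrefix δ r τ k - bitSign (τ k) * (δ * r ^ (k : ℕ)) =
      ∑ j, if k < j then bitSign (τ j) * (δ * r ^ (j : ℕ)) else 0 := by
    have : bitSign (τ k) * (δ * r ^ (k : ℕ)) =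
        ∑ j, if j = k then bitSign (τ j) * (δ * r ^ (j : ℕ)) else 0 := by simp
    rw [this, digitSum, digitPrefix, ← Finset.sum_sub_distrib, ← Finset.sum_sub_distrib]
    refine Finset.sum_congr rfl fun j _ => ?_
    rcases lt_trichotomy j k with h | h | h
    · simp [h, h.ne, h.not_gt]
    · simp [h]
    · simp [h, h.ne', h.not_gt]
  rw [e]
  calc _ ≤ ∑ j, |if k < j then bitSign (τ j) * (δ * r ^ (j : ℕ)) else 0| :=
        Finset.abs_sum_le_sum_abs _ _
    _ = δ * ∑ j : Fin m, if (k : ℕ) < (j : ℕ) then r ^ (j : ℕ) else 0 := by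
        rw [Finset.mul_sum]
        refine Finset.sum_congr rfl fun j _ => ?_
        simp only [Fin.lt_def]
        split_ifs
        · rw [abs_mul, abs_bitSign, one_mul, abs_of_nonneg (by positivity)]
        · simp
    _ ≤ _ := by
        rw [mul_div_assoc]
        exact mul_le_mul_of_nonneg_left (sum_fin_lt_pow_le h0 h1 m k) hδ

/-- The hidden vector that encodes, in each coordinate but the first, a row of signed digits. -/
noncomputable def digitVector (δ r : ℝ) (σ : Fin b × Fin m → Bool) :
    EuclideanSpace ℝ (Fin (b + 1)) :=
  WithLp.toLp 2 (Fin.cons (1 / 2) fun i => digitSum δ r fun j => σ (i, j))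

/-- The context that reveals the digit `q` of `digitVector`, with a gap of about `g`. -/
noncomputable def digitContext (δ r g : ℝ) (σ : Fin b × Fin m → Bool) (q : Fin b × Fin m) :
    EuclideanSpace ℝ (Fin (b + 1)) :=
  (g / (δ * r ^ (q.2 : ℕ))) •
    WithLp.toLp 2 (Fin.cons (-2 * digitPrefix δ r (fun j => σ (q.1, j)) q.2) (Pi.single q.1 1))

/-- The squared norm is at most `1/4 + b * (3/2 * δ) ^ 2 ≤ 1/4 + 9/16`. -/
theorem norm_digitVector_le {δ r : ℝ} (hδ : 0 ≤ δ) (hb : b * δ ^ 2 ≤ 1 / 4) (h0 : 0 ≤ r)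
    (h1 : r ≤ 1 / 3) (σ : Fin b × Fin m → Bool) : ‖digitVector δ r σ‖ ≤ 1 := by
  rw [EuclideanSpace.norm_eq]
  refine Real.sqrt_le_one.2 ?_
  simp only [digitVector, Fin.sum_univ_succ, Fin.cons_zero, Fin.cons_succ, Real.norm_eq_abs]
  have h : ∀ i : Fin b, |digitSum δ r fun j => σ (i, j)| ^ 2 ≤ (3 / 2 * δ) ^ 2 := fun i =>
    pow_le_pow_left₀ (abs_nonneg _) (abs_digitSum_le hδ h0 h1 _) 2
  have h' := Finset.sum_le_sum fun i (_ : i ∈ Finset.univ) => h i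
  rw [Finset.sum_const, Finset.card_univ, Fintype.card_fin, nsmul_eq_mul] at h'
  rw [abs_of_pos one_half_pos]
  nlinarith

theorem norm_digitContext_le {δ r g : ℝ} (hδ : 0 < δ) (hb : δ ≤ 1 / 2) (h0 : 0 < r)
    (h1 : r ≤ 1 / 3) (hg0 : 0 ≤ g) (hg : g ≤ δ * r ^ (m - 1) / 2) (σ : Fin b × Fin m → Bool)
    (q : Fin b × Fin m) : ‖digitContext δ r g σ q‖ ≤ 1 := by
  rw [digitContext, norm_smul, Real.norm_eq_abs, abs_of_nonneg (by positivity)]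
  have hs : g / (δ * r ^ (q.2 : ℕ)) ≤ 1 / 2 := by
    rw [div_le_div_iff₀ (by positivity) two_pos]
    have : r ^ (m - 1) ≤ r ^ (q.2 : ℕ) :=
      pow_le_pow_of_le_one h0.le (by linarith) (by omega)
    nlinarith
  have hn : ‖(WithLp.toLp 2 (Fin.cons (-2 * digitPrefix δ r (fun j => σ (q.1, j)) q.2)
      (Pi.single q.1 1)) : EuclideanSpace ℝ (Fin (b + 1)))‖ ≤ 2 := by
    rw [EuclideanSpace.norm_eq]
    refine Real.sqrt_le_iff.2 ⟨by norm_num, ?_⟩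
    simp only [Fin.sum_univ_succ, Fin.cons_zero, Fin.cons_succ, Real.norm_eq_abs, sq_abs]
    have h2 : ∑ i : Fin b, (Pi.single q.1 (1 : ℝ) : Fin b → ℝ) i ^ 2 = 1 := by
      rw [Finset.sum_eq_single q.1] <;> simp +contextual
    rw [h2]
    have h := abs_le.1 (abs_digitPrefix_le hδ.le h0.le h1 (fun j => σ (q.1, j)) q.2)
    nlinarith
  calc _ ≤ 1 / 2 * (2 : ℝ) := mul_le_mul hs hn (norm_nonneg _) (by norm_num)
    _ = 1 := by norm_num

/-- The entry `-2 * digitPrefix` meets the known coordinate `1/2` and cancels the digits before the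
current one. -/
theorem inner_digitContext_digitVector (δ r g : ℝ) (σ : Fin b × Fin m → Bool)
    (q : Fin b × Fin m) :
    inner ℝ (digitContext δ r g σ q) (digitVector δ r σ) = g / (δ * r ^ (q.2 : ℕ)) *
      (digitSum δ r (fun j => σ (q.1, j)) - digitPrefix δ r (fun j => σ (q.1, j)) q.2) := by
  rw [digitContext, real_inner_smul_left, digitVector, PiLp.inner_apply, Fin.sum_univ_succ]
  simp [Pi.single_apply]
  left
  ring

theorem inner_digitContext_sub (δ r g : ℝ) (σ σ' : Fin b × Fin m → Bool) (q : Fin b × Fin m) :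
    inner ℝ (digitContext δ r g σ q) (digitVector δ r σ' - digitVector δ r σ) =
      g / (δ * r ^ (q.2 : ℕ)) *
        (digitSum δ r (fun j => σ' (q.1, j)) - digitSum δ r (fun j => σ (q.1, j))) := by
  rw [digitContext, real_inner_smul_left, digitVector, digitVector, PiLp.inner_apply,
    Fin.sum_univ_succ]
  simp [Pi.single_apply]

end

/-! ### The hard family of instances, and the bound without switches. -/

section

variable {b m : ℕ}

/-- Negation of the bit `q`. -/
def flipBit (q : Fin b × Fin m) : Equiv.Perm (Fin b × Fin m → Bool) :=
  Function.Involutive.toPerm (fun σ => Function.update σ q (!σ q)) fun σ => by simp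

theorem flipBit_apply (q : Fin b × Fin m) (σ : Fin b × Fin m → Bool) :
    flipBit q σ = Function.update σ q (!σ q) := rfl

theorem flipBit_self (q : Fin b × Fin m) (σ : Fin b × Fin m → Bool) :
    flipBit q σ q = !σ q := by simp [flipBit_apply]

theorem flipBit_of_ne {q q' : Fin b × Fin m} (h : q' ≠ q) (σ : Fin b × Fin m → Bool) :
    flipBit q σ q' = σ q' := by simp [flipBit_apply, h]

theorem abs_digitSum_flipBit_sub {δ r : ℝ} (hδ : 0 ≤ δ) (h0 : 0 ≤ r) (q : Fin b × Fin m)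
    (σ : Fin b × Fin m → Bool) (i : Fin b) :
    |digitSum δ r (fun j => flipBit q σ (i, j)) - digitSum δ r (fun j => σ (i, j))| =
      if i = q.1 then 2 * (δ * r ^ (q.2 : ℕ)) else 0 := by
  rw [digitSum, digitSum, ← Finset.sum_sub_distrib]
  split_ifs with hi
  · subst hi
    rw [Finset.sum_eq_single q.2]
    · have : flipBit q σ (q.1, q.2) = !σ (q.1, q.2) := flipBit_self q σ
      rw [this, ← sub_mul, abs_mul, abs_of_nonneg (by positivity : 0 ≤ δ * r ^ (q.2 : ℕ))]
      cases σ (q.1, q.2) <;> norm_num [bitSign]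
    · intro j _ hj
      rw [flipBit_of_ne (fun h => hj (congrArg Prod.snd h)), sub_self]
    · simp
  · rw [Finset.sum_eq_zero, abs_zero]
    intro j _
    rw [flipBit_of_ne (fun h => hi (congrArg Prod.fst h)), sub_self]

/-- A context involves only the strictly earlier digits of its own coordinate, so the adversary's
choices leak nothing about a digit up to and including its slot. -/
theorem digitContext_flipBit (δ r g : ℝ) {q q' : Fin b × Fin m}
    (h : q.1 ≠ q'.1 ∨ q'.2 ≤ q.2) (σ : Fin b × Fin m → Bool) :
    digitContext δ r g (flipBit q σ) q' = digitContext δ r g σ q' := by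
  have : digitPrefix δ r (fun j => flipBit q σ (q'.1, j)) q'.2 =
      digitPrefix δ r (fun j => σ (q'.1, j)) q'.2 := by
    refine Finset.sum_congr rfl fun j _ => ?_
    split_ifs with hj
    · dsimp only
      rw [flipBit_of_ne]
      rintro rfl
      rcases h with h | h
      · exact h rfl
      · exact absurd hj h.not_gt
    · rfl
  rw [digitContext, digitContext, this]

/-- The contexts that show all the digits one after the other, each of them for `N` rounds. -/
noncomputable def digitContexts (δ r g : ℝ) (N : ℕ) (σ : Fin b × Fin m → Bool) (s : ℕ) :
    EuclideanSpace ℝ (Fin (b + 1)) :=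
  if h : s / N < b * m then digitContext δ r g σ (finProdFinEquiv.symm ⟨s / N, h⟩) else 0

theorem digitContexts_of_div_eq (δ r g : ℝ) {N : ℕ} (σ : Fin b × Fin m → Bool) {s : ℕ}
    {l : Fin (b * m)} (h : s / N = l) :
    digitContexts δ r g N σ s = digitContext δ r g σ (finProdFinEquiv.symm l) := by
  have h' : s / N < b * m := h ▸ l.isLt
  rw [digitContexts, dif_pos h']
  congr 2
  exact Fin.ext h

theorem finProdFinEquiv_symm_val (l : Fin (b * m)) :
    ((finProdFinEquiv.symm l).2 : ℕ) + m * ((finProdFinEquiv.symm l).1 : ℕ) = l :=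
  congrArg Fin.val (finProdFinEquiv.apply_symm_apply l)

/-- `9/32` bounds the accumulated information, and `4/3` is the constant that `SqDominated.test`
tolerates. The estimate is the eighth power of `exp (-9/256) ≥ 247/256`. -/
theorem exp_nine_div_le : Real.exp (9 / 32) ≤ 4 / 3 := by
  have h : Real.exp (9 / 32) * Real.exp (-(9 / 256)) ^ 8 = 1 := by
    rw [← Real.exp_nat_mul, ← Real.exp_add]
    norm_num
  have h1 : (247 / 256 : ℝ) ≤ Real.exp (-(9 / 256)) := by
    have := Real.add_one_le_exp (-(9 / 256) : ℝ)
    linarith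
  have h2 : (3 / 4 : ℝ) ≤ Real.exp (-(9 / 256)) ^ 8 :=
    le_trans (by norm_num) (pow_le_pow_left₀ (by norm_num) h1 8)
  nlinarith [Real.exp_pos (9 / 32)]

/-- In another coordinate the flip is invisible. In the same one, the slot `l'` magnifies by `g / (δ
* r ^ k')` a change of size `2 * δ * r ^ k`, and `k - k' = l - l'` because the digits of a
coordinate occupy consecutive slots. -/
theorem sq_inner_digitContext_le {δ r g : ℝ} (hδ : 0 < δ) (h0 : 0 < r)
    (σ : Fin b × Fin m → Bool) {l l' : Fin (b * m)} (hl : l' < l) :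
    inner ℝ (digitContext δ r g σ (finProdFinEquiv.symm l'))
      (digitVector δ r (flipBit (finProdFinEquiv.symm l) σ) - digitVector δ r σ) ^ 2 ≤
        4 * g ^ 2 * (r ^ 2) ^ ((l : ℕ) - (l' : ℕ)) := by
  have e := finProdFinEquiv_symm_val l
  have e' := finProdFinEquiv_symm_val l'
  have hl : (l' : ℕ) < l := hl
  set q := finProdFinEquiv.symm l
  set q' := finProdFinEquiv.symm l'
  rw [inner_digitContext_sub, mul_pow, ← sq_abs (digitSum _ _ _ - _),
    abs_digitSum_flipBit_sub hδ.le h0.le]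
  split_ifs with hi
  · rw [hi] at e'
    have hk : (q.2 : ℕ) = q'.2 + ((l : ℕ) - (l' : ℕ)) := by omega
    rw [hk, pow_add, ← pow_mul, mul_comm 2 ((l : ℕ) - (l' : ℕ)), pow_mul]
    refine le_of_eq ?_
    field_simp
    ring
  · rw [zero_pow two_ne_zero, mul_zero]
    positivity

theorem Learner.exists_expectedRegret_ge_of_digits (A : Learner.{u} (b + 1) 2) {T N : ℕ}
    (hb : 0 < b) (hm : 0 < m) (hN : 0 < N) (hT : b * m * N ≤ T) {r M : ℝ} (h0 : 0 < r)
    (h1 : r ≤ 1 / 3) (hr : N * r ^ (2 * m) ≤ b) (hM : 0 ≤ M)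
    (hA : ∀ B : Instance (b + 1) 2, A.expectedSwitches B T ≤ ENNReal.ofReal M) :
    ∃ B : Instance (b + 1) 2,
      r ^ (m - 1) / (8 * Real.sqrt b) * N * (b * m / 3 - M) ≤ A.expectedRegret B T := by
  have : NeZero N := ⟨hN.ne'⟩
  have hb1 : (1 : ℝ) ≤ b := by exact_mod_cast hb
  have hsb : 1 ≤ Real.sqrt b := Real.one_le_sqrt.2 hb1
  have hsq : Real.sqrt b ^ 2 = b := Real.sq_sqrt (by linarith)
  -- The scale at which `b` coordinates of size about `δ` still fit into the unit ball: `b * δ ^ 2 =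
  -- 1/4`.
  obtain ⟨δ, hδ⟩ : ∃ δ : ℝ, δ = 1 / (2 * Real.sqrt b) := ⟨_, rfl⟩
  -- Half the size of the last digit, so that even its context is magnified by at most `1/2`.
  obtain ⟨g, hg⟩ : ∃ g : ℝ, g = δ * r ^ (m - 1) / 2 := ⟨_, rfl⟩
  have hδ0 : 0 < δ := by rw [hδ]; positivity
  have hδ1 : δ ≤ 1 / 2 := by
    rw [hδ, div_le_div_iff₀ (by positivity) two_pos]
    linarith
  have hδ2 : b * δ ^ 2 = 1 / 4 := by
    rw [hδ, div_pow, mul_pow, hsq]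
    field_simp
    norm_num
  have hg0 : 0 ≤ g := by rw [hg]; positivity
  have hdiv : ∀ (l : Fin (b * m)) (j : Fin N), ((j : ℕ) + N * l) / N = l := by
    intro l j
    rw [Nat.add_mul_div_left _ _ hN, Nat.div_eq_of_lt j.isLt, zero_add]
  have hdiv0 : ∀ l : Fin (b * m), (N * l) / N = (l : ℕ) := fun l => Nat.mul_div_cancel_left _ hN
  have hy : ∀ (σ : Fin b × Fin m → Bool) (t : ℕ), ‖digitContexts δ r g N σ t‖ ≤ 1 := by
    intro σ t
    rw [digitContexts]
    split_ifs
    · exact norm_digitContext_le hδ0 hδ1 h0 h1 hg0 hg.le σ _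
    · simp
  have hw : r ^ (m - 1) / (8 * Real.sqrt b) = g / 2 := by
    rw [hg, hδ]
    field_simp
    norm_num
  have hcast : ((b * m : ℕ) : ℝ) = b * m := by push_cast; ring
  rw [hw, ← hcast]
  refine (A.exists_expectedRegret_ge hT (w := g / 2) (M := M) (digitVector δ r)
    (norm_digitVector_le hδ0.le hδ2.le h0.le h1) (digitContexts δ r g N) hy
    (fun l => flipBit (finProdFinEquiv.symm l))
    (fun σ l => if σ (finProdFinEquiv.symm l) then 1 else 0) (by positivity) ?_ ?_ ?_ ?_ ?_ ?_).imp'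
    (fun σ => _) fun σ h => h
  · intro σ l
    rw [flipBit_self]
    cases σ (finProdFinEquiv.symm l) <;> simp
  · intro σ l s hs
    have hle : s / N ≤ l := (Nat.div_le_div_right hs).trans (hdiv0 l).le
    have hlt : s / N < b * m := hle.trans_lt l.isLt
    rw [digitContexts_of_div_eq δ r g _ (l := ⟨s / N, hlt⟩) rfl,
      digitContexts_of_div_eq δ r g _ (l := ⟨s / N, hlt⟩) rfl]
    refine digitContext_flipBit δ r g ?_ σ
    by_contra! hne
    have e := finProdFinEquiv_symm_val l
    have e' := finProdFinEquiv_symm_val (⟨s / N, hlt⟩ : Fin (b * m))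
    rw [← hne.1] at e'
    have := Fin.lt_def.1 hne.2
    simp only at e'
    omega
  · intro σ l j
    rw [digitContexts_of_div_eq δ r g σ (hdiv l j), digitContexts_of_div_eq δ r g σ (hdiv0 l)]
  · intro σ l
    refine le_trans (Real.exp_le_exp.2 ?_) exp_nine_div_le
    have hbd : ∀ s ∈ Finset.range (N * l), inner ℝ (digitContexts δ r g N σ s)
        (digitVector δ r (flipBit (finProdFinEquiv.symm l) σ) - digitVector δ r σ) ^ 2 ≤
          4 * g ^ 2 * (r ^ 2) ^ ((l : ℕ) - s / N) := by
      intro s hs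
      have hlt : s / N < l := Nat.div_lt_of_lt_mul (Finset.mem_range.1 hs)
      rw [digitContexts_of_div_eq δ r g σ (l := ⟨s / N, hlt.trans l.isLt⟩) rfl]
      exact sq_inner_digitContext_le hδ0 h0 σ hlt
    refine (Finset.sum_le_sum hbd).trans ?_
    rw [sum_range_mul_div hN (fun k => 4 * g ^ 2 * (r ^ 2) ^ ((l : ℕ) - k)), ← Finset.mul_sum]
    have hx : r ^ 2 ≤ 1 / 9 := by nlinarith
    have h2 := sum_range_pow_sub_le (sq_nonneg r) hx l
    have h3 : g ^ 2 * r ^ 2 = δ ^ 2 * r ^ (2 * m) / 4 := by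
      rw [hg]
      obtain ⟨k, rfl⟩ : ∃ k, m = k + 1 := ⟨m - 1, by omega⟩
      simp only [Nat.add_sub_cancel]
      ring
    -- The geometric series is dominated by the slot just before; `N * r ^ (2 * m) ≤ b` balances the
    -- length of a slot against this leakage.
    calc _ ≤ N * (4 * g ^ 2 * (9 / 8 * r ^ 2)) := by gcongr
      _ = 9 / 8 * δ ^ 2 * (N * r ^ (2 * m)) := by linear_combination (9 / 2 * N) * h3
      _ ≤ 9 / 8 * δ ^ 2 * b := by gcongr
      _ = 9 / 32 := by linear_combination (9 / 8) * hδ2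
  · intro σ l
    rw [digitContexts_of_div_eq δ r g σ (hdiv0 l), inner_digitContext_digitVector]
    set q := finProdFinEquiv.symm l
    have h := abs_le.1 (abs_digitSum_sub_digitPrefix_sub_le hδ0.le h0.le h1
      (fun j => σ (q.1, j)) q.2)
    have hs : 0 ≤ g / (δ * r ^ (q.2 : ℕ)) := by positivity
    have e : g / (δ * r ^ (q.2 : ℕ)) * (δ * r ^ (q.2 : ℕ) / 2) = g / 2 := by field_simp
    rw [← e]
    simp only [Prod.mk.eta] at h
    cases hσ : σ q
    · simp only [hσ, bitSign, Bool.false_eq_true, if_false] at h ⊢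
      rw [if_neg (by decide), ← mul_neg]
      exact mul_le_mul_of_nonneg_left (by linarith [h.2]) hs
    · simp only [hσ, bitSign, if_true] at h ⊢
      exact mul_le_mul_of_nonneg_left (by linarith [h.1]) hs
  · intro σ
    simp only [measureReal_def]
    rw [← ENNReal.toReal_sum fun l _ => measure_ne_top _ _]
    exact ENNReal.toReal_le_of_le_ofReal hM ((A.sum_slotSwitch_le _ hT _ _).trans (hA _))

/-- Without any restriction on the switches. -/
theorem Learner.exists_expectedRegret_ge_sqrt (A : Learner.{u} (b + 1) 2) {T : ℕ} (hT : 0 < T) :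
    ∃ B : Instance (b + 1) 2, Real.sqrt T / 12 ≤ A.expectedRegret B T := by
  have hT1 : (1 : ℝ) ≤ T := by exact_mod_cast hT
  have hs1 : 1 ≤ Real.sqrt T := Real.one_le_sqrt.2 hT1
  have hsq : Real.sqrt T ^ 2 = T := Real.sq_sqrt (by linarith)
  -- Two instances with the means `± ε`: the information over `T` rounds is at most `4 * T * ε ^ 2 =
  -- 1/4 ≤ 9/32`.
  obtain ⟨ε, hε⟩ : ∃ ε : ℝ, ε = 1 / (4 * Real.sqrt T) := ⟨_, rfl⟩
  have hε0 : 0 ≤ ε := by rw [hε]; positivity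
  have hε1 : ε ≤ 1 := by
    rw [hε, div_le_one (by positivity)]
    linarith
  have hε2 : T * ε ^ 2 = 1 / 16 := by
    rw [hε, div_pow, mul_pow, hsq]
    field_simp
    norm_num
  have hn : T * 1 ≤ T := (mul_one T).le
  have he : Real.sqrt T / 12 = ε * (1 : ℕ) * (T / 3 - 0) := by
    rw [hε, sub_zero, Nat.cast_one, mul_one]
    field_simp
    linear_combination 12 * hsq
  rw [he]
  refine (A.exists_expectedRegret_ge hn (Ω := Bool) (w := ε) (M := 0)
    (fun c => EuclideanSpace.single 0 (bitSign c * ε)) ?_ (fun _ _ => EuclideanSpace.single 0 1) ?_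
    (fun _ => Equiv.boolNot) (fun c _ => if c then 1 else 0) hε0 ?_ ?_ ?_ ?_ ?_ ?_).imp'
    (fun σ => _) fun σ h => h
  · intro c
    rw [PiLp.norm_single, Real.norm_eq_abs, abs_mul, abs_bitSign, one_mul,
      abs_of_nonneg hε0]
    exact hε1
  · intro _ _
    simp
  · intro c _
    cases c <;> simp
  · intro _ _ _ _
    rfl
  · intro _ _ _
    rfl
  · intro c l
    refine le_trans (Real.exp_le_exp.2 ?_) exp_nine_div_le
    have h : ∀ s ∈ Finset.range (1 * (l : ℕ)),
        inner ℝ (EuclideanSpace.single (0 : Fin (b + 1)) (1 : ℝ))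
          (EuclideanSpace.single 0 (bitSign (Equiv.boolNot c) * ε) -
            EuclideanSpace.single 0 (bitSign c * ε)) ^ 2 = 4 * ε ^ 2 := by
      intro s _
      rw [EuclideanSpace.inner_single_left]
      cases c <;> simp [bitSign] <;> ring
    rw [Finset.sum_congr rfl h, Finset.sum_const, Finset.card_range, nsmul_eq_mul, one_mul]
    have hl : ((l : ℕ) : ℝ) ≤ T := by exact_mod_cast l.isLt.le
    nlinarith [sq_nonneg ε]
  · intro c l
    rw [EuclideanSpace.inner_single_left]
    cases c <;> simp [bitSign]
  · intro c
    -- Every slot is a single round, so nothing can change within a slot and `M = 0` is allowed.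
    refine (Finset.sum_eq_zero fun l _ => ?_).le
    have : A.slotSwitch hn ![EuclideanSpace.single 0 1, 0] (if c then 1 else 0) l = ∅ := by
      ext p
      simp only [Learner.slotSwitch, Set.mem_ofPred_eq, Set.mem_empty_iff_false, iff_false,
        not_exists, not_not]
      intro j
      rw [Subsingleton.elim j 0]
    rw [this]
    simp

end

/-! ### Choice of the parameters, and the two claims. -/

section

theorem Learner.exists_expectedRegret_ge_of_switches {b m T : ℕ} (A : Learner.{u} (b + 1) 2)
    (hb : 0 < b) (hm : 0 < m) (hT : (9 ^ m * b ^ 2 * m : ℝ) ≤ T) {M : ℝ} (hM : 0 ≤ M)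
    (hMb : M ≤ b * m / 4)
    (hA : ∀ B : Instance (b + 1) 2, A.expectedSwitches B T ≤ ENNReal.ofReal M) :
    ∃ B : Instance (b + 1) 2, Real.sqrt (T * m * b) / 192 *
      (T / (b ^ 2 * m) : ℝ) ^ (1 / (2 * m : ℝ)) ≤ A.expectedRegret B T := by
  have hb1 : (1 : ℝ) ≤ b := by exact_mod_cast hb
  have hm1 : (1 : ℝ) ≤ m := by exact_mod_cast hm
  have h9 : (1 : ℝ) ≤ 9 ^ m := one_le_pow₀ (by norm_num)
  have hbm : 0 < b * m := Nat.mul_pos hb hm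
  have hbmT : b * m ≤ T := by
    have : (b * m : ℝ) ≤ T := by
      refine le_trans ?_ hT
      have h1 : (1 : ℝ) * b ≤ 9 ^ m * b ^ 2 := by nlinarith
      nlinarith
    exact_mod_cast this
  have hT0 : (0 : ℝ) < T := by exact_mod_cast hbm.trans_le hbmT
  obtain ⟨N, hN⟩ : ∃ N, N = T / (b * m) := ⟨_, rfl⟩
  have hN0 : 0 < N := hN ▸ Nat.div_pos hbmT hbm
  have hNT : b * m * N ≤ T := hN ▸ Nat.mul_div_le T (b * m)
  have hNT' : (b * m * N : ℝ) ≤ T := by exact_mod_cast hNT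
  have hTN : (T : ℝ) ≤ 2 * (b * m * N) := by
    have h1 : T < b * m * (N + 1) := by
      rw [hN]
      exact Nat.lt_mul_div_succ T hbm
    have h2 : b * m ≤ b * m * N := Nat.le_mul_of_pos_right _ hN0
    have h3 : T ≤ 2 * (b * m * N) := by rw [Nat.mul_succ] at h1; omega
    exact_mod_cast h3
  -- With `N ≤ T / (b * m)` this `r` satisfies `N * r ^ (2 * m) ≤ b`; the hypothesis on `9 ^ m` says
  -- exactly that `r ≤ 1/3`.
  obtain ⟨r, hr⟩ : ∃ r : ℝ, r = (b ^ 2 * m / T : ℝ) ^ (1 / (2 * m : ℝ)) := ⟨_, rfl⟩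
  have hr0 : 0 < r := by rw [hr]; positivity
  have hr2 : r ^ (2 * m) = b ^ 2 * m / T := by
    rw [hr, ← Real.rpow_natCast, ← Real.rpow_mul (by positivity)]
    push_cast
    rw [one_div_mul_cancel (by positivity), Real.rpow_one]
  have hr3 : r ≤ 1 / 3 := by
    refine le_of_pow_le_pow_left₀ (n := 2 * m) (by omega) (by norm_num) ?_
    rw [hr2, pow_mul, div_le_iff₀ hT0, div_pow, div_pow, one_pow, one_pow, one_div, ← div_eq_inv_mul,
      le_div_iff₀ (by positivity)]
    norm_num
    linarith
  have hrN : N * r ^ (2 * m) ≤ b := by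
    rw [hr2, mul_div_assoc', div_le_iff₀ hT0]
    nlinarith
  obtain ⟨B, hB⟩ := A.exists_expectedRegret_ge_of_digits hb hm hN0 hNT hr0 hr3 hrN hM hA
  refine ⟨B, le_trans ?_ hB⟩
  have hinv : (T / (b ^ 2 * m) : ℝ) ^ (1 / (2 * m : ℝ)) = r⁻¹ := by
    rw [hr, ← Real.inv_rpow (by positivity), inv_div]
  have hsb : 0 < Real.sqrt b := Real.sqrt_pos.2 (by linarith)
  have hsq : Real.sqrt (T * m * b) = T * r ^ m / Real.sqrt b := by
    rw [← Real.sqrt_sq (by positivity : 0 ≤ T * r ^ m / Real.sqrt b), div_pow, mul_pow,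
      Real.sq_sqrt (by linarith : (0 : ℝ) ≤ b), ← pow_mul, mul_comm m 2, hr2]
    congr 1
    field_simp
  have hrm : r ^ m * r⁻¹ = r ^ (m - 1) := by
    obtain ⟨k, rfl⟩ : ∃ k, m = k + 1 := ⟨m - 1, by omega⟩
    rw [Nat.add_sub_cancel, pow_succ, mul_assoc, mul_inv_cancel₀ hr0.ne', mul_one]
  calc _ = r ^ (m - 1) / (8 * Real.sqrt b) * (T / 24) := by
        rw [hinv, hsq, ← hrm]
        field_simp
        norm_num
    _ ≤ r ^ (m - 1) / (8 * Real.sqrt b) * (N * (b * m / 3 - M)) := by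
        refine mul_le_mul_of_nonneg_left ?_ (by positivity)
        have : (N : ℝ) * (b * m / 12) ≤ N * (b * m / 3 - M) := by
          gcongr
          linarith
        linarith
    _ = _ := by ring

theorem natCast_le_two_pow (m : ℕ) : (m : ℝ) ≤ 2 ^ m := by
  exact_mod_cast Nat.lt_two_pow_self.le

theorem exists_expectedRegret_ge_of_switches_le {d T : ℕ} {M : ℝ} (hd : 2 ≤ d) (hdT : (d : ℝ) ≤ T)
    (hM : 20 * d ≤ M) (hMT : M ≤ d * Real.log T / 48) (A : Learner.{u} d 2)
    (hA : ∀ B : Instance d 2, A.expectedSwitches B T ≤ ENNReal.ofReal M) :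
    ∃ B : Instance d 2,
      Real.sqrt (d * T) * (1 / (32 * d)) * (2 * T / d : ℝ) ^ (1 / (16 * M / d + 2))
        ≤ A.expectedRegret B T := by
  obtain ⟨b, rfl⟩ : ∃ b, d = b + 1 := ⟨d - 1, by omega⟩
  have hb : 0 < b := by omega
  have hb1 : (1 : ℝ) ≤ b := by exact_mod_cast hb
  obtain ⟨D, hD⟩ : ∃ D : ℝ, D = ((b + 1 : ℕ) : ℝ) := ⟨_, rfl⟩
  rw [← hD] at hdT hM hMT ⊢
  have hDb : D = b + 1 := by rw [hD]; push_cast; rfl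
  have hD0 : 0 < D := by linarith
  have hT0 : (0 : ℝ) < T := by linarith
  have hM0 : 0 ≤ M := by linarith
  -- Since `D ≤ 2 * b`, this gives `M ≤ D * m / 8 ≤ b * m / 4`, while `2 * m ≤ 16 * M / D + 2`
  -- matches the exponent of the claim.
  obtain ⟨m, hm⟩ : ∃ m, m = ⌈8 * M / D⌉₊ := ⟨_, rfl⟩
  have hm1 : 8 * M / D ≤ m := hm ▸ Nat.le_ceil _
  have hm2 : (m : ℝ) < 8 * M / D + 1 := hm ▸ Nat.ceil_lt_add_one (by positivity)
  have hm160 : (160 : ℝ) ≤ m := by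
    refine le_trans ?_ hm1
    rw [le_div_iff₀ hD0]
    linarith
  have hm0 : 0 < m := by
    have : (0 : ℝ) < m := by linarith
    exact_mod_cast this
  have hMm : M ≤ b * m / 4 := by
    rw [div_le_iff₀ hD0] at hm1
    nlinarith
  have h2m : 2 * (m : ℝ) ≤ 16 * M / D + 2 := by
    have : 16 * M / D = 2 * (8 * M / D) := by ring
    linarith
  have hbase : 1 ≤ 2 * T / D := by
    rw [le_div_iff₀ hD0]
    linarith
  by_cases hcase : (9 ^ m * b ^ 2 * m : ℝ) ≤ T
  · obtain ⟨B, hB⟩ := A.exists_expectedRegret_ge_of_switches hb hm0 hcase hM0 hMm hA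
    refine ⟨B, le_trans ?_ hB⟩
    have h1 : (2 * T / D : ℝ) ^ (1 / (16 * M / D + 2)) ≤ (T : ℝ) ^ (1 / (2 * m : ℝ)) := by
      calc _ ≤ (2 * T / D : ℝ) ^ (1 / (2 * m : ℝ)) :=
            Real.rpow_le_rpow_of_exponent_le hbase
              (one_div_le_one_div_of_le (by positivity) h2m)
        _ ≤ _ := by
            refine Real.rpow_le_rpow (by positivity) ?_ (by positivity)
            rw [div_le_iff₀ hD0]
            nlinarith
    -- The loss from replacing `T / (b ^ 2 * m)` by `T` under the root. It is at most `√2 * b`,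
    -- because `m * b ^ 2 ≤ 2 ^ m * b ^ (2 * m)`; the factor `√m` with `m ≥ 160` absorbs the
    -- constants.
    obtain ⟨v, hv⟩ : ∃ v : ℝ, v = (b ^ 2 * m : ℝ) ^ (1 / (2 * m : ℝ)) := ⟨_, rfl⟩
    have hv0 : 0 < v := by rw [hv]; positivity
    have hv2 : v ≤ Real.sqrt 2 * b := by
      refine le_of_pow_le_pow_left₀ (n := 2 * m) (by omega) (by positivity) ?_
      rw [hv, ← Real.rpow_natCast, ← Real.rpow_mul (by positivity)]
      push_cast
      rw [one_div_mul_cancel (by positivity), Real.rpow_one, mul_pow, pow_mul (Real.sqrt 2),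
        Real.sq_sqrt (by norm_num), mul_comm]
      refine mul_le_mul (natCast_le_two_pow m) ?_ (by positivity) (by positivity)
      exact pow_le_pow_right₀ hb1 (by omega)
    have hv3 : v ^ 2 ≤ 2 * b ^ 2 := by
      calc v ^ 2 ≤ (Real.sqrt 2 * b) ^ 2 := by gcongr
        _ = _ := by rw [mul_pow, Real.sq_sqrt (by norm_num)]
    have h2 : Real.sqrt (D * T) * (1 / (32 * D)) ≤ Real.sqrt (T * m * b) / 192 * v⁻¹ := by
      have : Real.sqrt (D * T) * (6 * v) ≤ Real.sqrt (T * m * b) * D := by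
        refine abs_le_of_sq_le_sq' ?_ (by positivity) |>.2
        rw [mul_pow, mul_pow _ D, Real.sq_sqrt (by positivity), Real.sq_sqrt (by positivity)]
        have e1 : 72 * (b : ℝ) ≤ m * D := by nlinarith
        calc D * T * (6 * v) ^ 2 = 36 * D * T * v ^ 2 := by ring
          _ ≤ 36 * D * T * (2 * b ^ 2) := by gcongr
          _ = T * b * D * (72 * b) := by ring
          _ ≤ T * b * D * (m * D) := by gcongr
          _ = _ := by ring
      rw [mul_one_div, ← div_eq_mul_inv, div_div, div_le_div_iff₀ (by positivity) (by positivity)]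
      nlinarith
    rw [Real.div_rpow hT0.le (by positivity), ← hv, div_eq_mul_inv _ v, mul_comm (_ ^ _) v⁻¹,
      ← mul_assoc]
    exact mul_le_mul h2 h1 (by positivity) (by positivity)
  -- Here the base cannot be taken large enough. From `9 ^ m * m ≤ 18 ^ m ≤ exp (3 * m) ≤ 21 * √T`
  -- it follows that `√T ≤ 21 * D ^ 2`. Then `2 * T / D` is polynomial in `D`, its small power is at
  -- most `2 * √D`, and the claim reduces to `√T / 16`.
  · push Not at hcase
    obtain ⟨B, hB⟩ := A.exists_expectedRegret_ge_sqrt (T := T) (by exact_mod_cast hT0)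
    refine ⟨B, le_trans ?_ hB⟩
    have he1 : (18 : ℝ) ≤ Real.exp 3 := by
      have h := Real.exp_one_gt_d9
      have : Real.exp 3 = Real.exp 1 ^ 3 := by rw [← Real.exp_nat_mul]; norm_num
      rw [this]
      calc (18 : ℝ) ≤ 2.7 ^ 3 := by norm_num
        _ ≤ _ := by gcongr; linarith
    have he2 : Real.exp 3 ≤ 21 := by
      have h := Real.exp_one_lt_d9
      have : Real.exp 3 = Real.exp 1 ^ 3 := by rw [← Real.exp_nat_mul]; norm_num
      rw [this]
      calc Real.exp 1 ^ 3 ≤ 2.75 ^ 3 := by gcongr; linarith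
        _ ≤ _ := by norm_num
    have hlog : 8 * M / D ≤ Real.log T / 6 := by
      rw [div_le_iff₀ hD0]
      linarith
    have h18 : (18 : ℝ) ^ m ≤ 21 * Real.sqrt T := by
      calc (18 : ℝ) ^ m ≤ Real.exp 3 ^ m := by gcongr
        _ = Real.exp (m * 3) := by rw [← Real.exp_nat_mul]
        _ ≤ Real.exp (3 + Real.log T / 2) := Real.exp_le_exp.2 (by linarith)
        _ = Real.exp 3 * Real.sqrt T := by
            rw [Real.exp_add, ← Real.log_sqrt hT0.le, Real.exp_log (Real.sqrt_pos.2 hT0)]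
        _ ≤ _ := by gcongr
    have hsT : Real.sqrt T ^ 2 = T := Real.sq_sqrt hT0.le
    have hsT0 : 0 < Real.sqrt T := Real.sqrt_pos.2 hT0
    have hT1 : Real.sqrt T ≤ 21 * D ^ 2 := by
      have h1 : (T : ℝ) ≤ 21 * Real.sqrt T * D ^ 2 := by
        calc (T : ℝ) ≤ 9 ^ m * b ^ 2 * m := hcase.le
          _ ≤ 9 ^ m * b ^ 2 * 2 ^ m := by gcongr; exact natCast_le_two_pow m
          _ = 18 ^ m * b ^ 2 := by
              rw [show (18 : ℝ) = 9 * 2 by norm_num, mul_pow]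
              ring
          _ ≤ 21 * Real.sqrt T * D ^ 2 := by
              gcongr
              linarith
      nlinarith
    have hT2 : 2 * T / D ≤ 882 * D ^ 3 := by
      rw [div_le_iff₀ hD0, ← hsT]
      nlinarith
    have hsD : Real.sqrt D ^ 2 = D := Real.sq_sqrt hD0.le
    have hpow : (2 * T / D : ℝ) ^ (1 / (16 * M / D + 2)) ≤ 2 * Real.sqrt D := by
      calc _ ≤ (2 * T / D : ℝ) ^ ((20 : ℕ) : ℝ)⁻¹ := by
            refine Real.rpow_le_rpow_of_exponent_le hbase ?_
            rw [← one_div]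
            refine one_div_le_one_div_of_le (by norm_num) ?_
            norm_num
            linarith
        _ ≤ ((2 * Real.sqrt D) ^ 20) ^ ((20 : ℕ) : ℝ)⁻¹ := by
            refine Real.rpow_le_rpow (by positivity) (hT2.trans ?_) (by positivity)
            rw [mul_pow, show (20 : ℕ) = 2 * 10 by norm_num, pow_mul (Real.sqrt D), hsD]
            have : D ^ 3 ≤ D ^ 10 := pow_le_pow_right₀ (by linarith) (by norm_num)
            norm_num
            nlinarith [pow_pos hD0 3]
        _ = _ := Real.pow_rpow_inv_natCast (by positivity) (by norm_num)
    calc _ ≤ Real.sqrt (D * T) * (1 / (32 * D)) * (2 * Real.sqrt D) := by gcongr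
      _ = Real.sqrt T / 16 := by
          rw [Real.sqrt_mul hD0.le]
          field_simp
          rw [hsD]
          field_simp
          norm_num
      _ ≤ _ := by linarith

theorem exists_switches_ge_of_expectedRegret_le {a : ℝ} (ha : 0 ≤ a) :
    ∃ c : ℝ, 0 < c ∧ ∀ G : ℝ, 0 < G → ∃ T₀ : ℝ, 0 < T₀ ∧
      ∀ d T : ℕ, 2 ≤ d → T₀ ≤ T → T₀ * d ^ 2 * Real.log T ^ (2 * a) ≤ T →
        ∀ A : Learner.{u} d 2,
          (∀ B : Instance d 2,
            A.expectedRegret B T ≤ G * Real.sqrt (d * T) * Real.log T ^ a) →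
          ∃ B : Instance d 2,
            ENNReal.ofReal (c * (d * Real.log T / Real.log (d * Real.log T)))
              ≤ A.expectedSwitches B T := by
  obtain ⟨c, hc⟩ : ∃ c : ℝ, c = 1 / (16 * (4 + 2 * a)) := ⟨_, rfl⟩
  have hc0 : 0 < c := by rw [hc]; positivity
  refine ⟨c, hc0, fun G hG => ?_⟩
  -- `κ / 192` exceeds `2 * G`, which yields the final contradiction, and `κ ≥ 3` yields `r ≤ 1/3`.
  obtain ⟨κ, hκ⟩ : ∃ κ : ℝ, κ = 384 * G + 3 := ⟨_, rfl⟩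
  have hκ3 : 3 ≤ κ := by linarith
  -- The term `exp κ` ensures `κ ≤ log T`; the term `κ ^ 2` serves the case of a single digit.
  refine ⟨κ ^ 2 + Real.exp κ, by positivity, fun d T hd hT hT2 A hA => ?_⟩
  by_contra! hno
  obtain ⟨b, rfl⟩ : ∃ b, d = b + 1 := ⟨d - 1, by omega⟩
  have hb : 0 < b := by omega
  have hb1 : (1 : ℝ) ≤ b := by exact_mod_cast hb
  obtain ⟨D, hD⟩ : ∃ D : ℝ, D = ((b + 1 : ℕ) : ℝ) := ⟨_, rfl⟩
  rw [← hD] at hT2 hA hno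
  have hDb : D = b + 1 := by rw [hD]; push_cast; rfl
  have hD0 : 0 < D := by linarith
  have hT0 : (0 : ℝ) < T := lt_of_lt_of_le (by positivity) hT
  obtain ⟨L, hL⟩ : ∃ L : ℝ, L = Real.log T := ⟨_, rfl⟩
  rw [← hL] at hT2 hA hno
  have hexpL : Real.exp L = T := by rw [hL, Real.exp_log hT0]
  have hLκ : κ ≤ L := by
    rw [← Real.exp_le_exp, hexpL]
    linarith [sq_nonneg κ]
  obtain ⟨W, hW⟩ : ∃ W : ℝ, W = D * L := ⟨_, rfl⟩
  have hLW : L ≤ W := by rw [hW]; nlinarith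
  have hDW : D ≤ W := by rw [hW]; nlinarith
  rw [← hW] at hno
  have hW1 : 1 < W := by linarith
  have hw0 : 0 < Real.log W := Real.log_pos hW1
  obtain ⟨x, hx⟩ : ∃ x : ℝ, x = 8 * c * L / Real.log W := ⟨_, rfl⟩
  have hx0 : 0 < x := by
    have : 0 < L := by linarith
    rw [hx]
    positivity
  have hMx : c * (W / Real.log W) = D * x / 8 := by
    rw [hx, hW]
    field_simp
  rw [hMx] at hno
  obtain ⟨m, hm⟩ : ∃ m, m = ⌈x⌉₊ := ⟨_, rfl⟩
  have hm0 : 0 < m := hm ▸ Nat.ceil_pos.2 hx0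
  have hm1 : (1 : ℝ) ≤ m := by exact_mod_cast hm0
  have hxm : x ≤ m := hm ▸ Nat.le_ceil _
  have hmx : (m : ℝ) < x + 1 := hm ▸ Nat.ceil_lt_add_one hx0.le
  have hLa : 1 ≤ L ^ a := Real.one_le_rpow (by linarith) ha
  -- This says that the gain `(T / (b ^ 2 * m)) ^ (1 / (2 * m))` is at least `κ * L ^ a`. For `m =
  -- 1` it is the assumed lower bound on `T`. For `m ≥ 2` rounding up costs at most a factor `2`,
  -- and every factor is bounded by a power of `W = D * L`: the product is at most `W ^ (m * (4 + 2
  -- * a)) ≤ exp L`, which is what fixes `c`.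
  have key : (κ * L ^ a) ^ (2 * m) * (b ^ 2 * m) ≤ T := by
    by_cases hm' : m = 1
    · rw [hm']
      have e : L ^ (2 * a) = (L ^ a) ^ 2 := by
        rw [← Real.rpow_natCast, ← Real.rpow_mul (by linarith), mul_comm]
        norm_num
      rw [e] at hT2
      calc (κ * L ^ a) ^ (2 * 1) * (b ^ 2 * ((1 : ℕ) : ℝ)) = κ ^ 2 * b ^ 2 * (L ^ a) ^ 2 := by
            push_cast
            ring
        _ ≤ (κ ^ 2 + Real.exp κ) * D ^ 2 * (L ^ a) ^ 2 := by
            gcongr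
            · linarith [Real.exp_pos κ]
            · linarith
        _ ≤ T := hT2
    · have h : 2 ≤ m := by omega
      have hm2 : (2 : ℝ) ≤ m := by exact_mod_cast h
      obtain ⟨w, hw⟩ : ∃ w : ℝ, w = Real.log W := ⟨_, rfl⟩
      rw [← hw] at hw0 hx
      have hWw : Real.exp w = W := by rw [hw, Real.exp_log (by linarith)]
      have hmw : m * w * (4 + 2 * a) ≤ L := by
        have e : x * w = 8 * c * L := by rw [hx, div_mul_cancel₀ _ hw0.ne']
        have h1 : m * w ≤ 16 * c * L := by nlinarith
        have h2 : 16 * c * (4 + 2 * a) = 1 := by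
          rw [hc]
          field_simp
        calc _ ≤ 16 * c * L * (4 + 2 * a) := by gcongr
          _ = L := by linear_combination L * h2
      have h1 : κ * L ^ a ≤ Real.exp (w * (1 + a)) := by
        have e : Real.exp (w * (1 + a)) = W * W ^ a := by
          rw [Real.rpow_def_of_pos (by linarith), ← hw, mul_add, mul_one, Real.exp_add, hWw]
        rw [e]
        exact mul_le_mul (hLκ.trans hLW) (Real.rpow_le_rpow (by linarith) hLW ha)
          (by positivity) (by linarith)
      have h2 : (b : ℝ) ^ 2 ≤ W ^ m := by
        calc (b : ℝ) ^ 2 ≤ W ^ 2 := by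
              gcongr
              linarith
          _ ≤ W ^ m := pow_le_pow_right₀ hW1.le h
      have h3 : (m : ℝ) ≤ W ^ m := by
        refine (natCast_le_two_pow m).trans ?_
        gcongr
        linarith
      calc _ ≤ Real.exp (w * (1 + a)) ^ (2 * m) * (W ^ m * W ^ m) := by gcongr
        _ = Real.exp (m * w * (4 + 2 * a)) := by
            rw [← hWw, ← Real.exp_nat_mul, ← Real.exp_nat_mul, ← Real.exp_add, ← Real.exp_add]
            push_cast
            congr 1
            ring
        _ ≤ T := by
            rw [← hexpL]
            exact Real.exp_le_exp.2 hmw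
  have h9 : (9 ^ m * b ^ 2 * m : ℝ) ≤ T := by
    refine le_trans ?_ key
    rw [mul_assoc, show (9 : ℝ) = 3 ^ 2 by norm_num, ← pow_mul]
    gcongr
    nlinarith
  have hMb : D * x / 8 ≤ b * m / 4 := by
    have : D * x ≤ 2 * b * m := by
      gcongr
      linarith
    linarith
  obtain ⟨B, hB⟩ := A.exists_expectedRegret_ge_of_switches hb hm0 h9
    (by positivity : 0 ≤ D * x / 8) hMb fun B => (hno B).le
  have hV : κ * L ^ a ≤ (T / (b ^ 2 * m) : ℝ) ^ (1 / (2 * m : ℝ)) := by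
    refine le_of_pow_le_pow_left₀ (n := 2 * m) (by omega) (by positivity) ?_
    rw [← Real.rpow_natCast (_ ^ _), ← Real.rpow_mul (by positivity)]
    push_cast
    rw [one_div_mul_cancel (by positivity), Real.rpow_one, le_div_iff₀ (by positivity)]
    exact key
  have hS : Real.sqrt (D * T) ≤ 2 * Real.sqrt (T * m * b) := by
    refine Real.sqrt_le_iff.2 ⟨by positivity, ?_⟩
    rw [mul_pow, Real.sq_sqrt (by positivity)]
    have h1 : (b : ℝ) ≤ m * b := le_mul_of_one_le_left (by linarith) hm1
    calc D * T ≤ 4 * (m * b) * T := by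
          gcongr
          linarith
      _ = _ := by ring
  have hS0 : 0 < Real.sqrt (T * m * b) := Real.sqrt_pos.2 (by positivity)
  have h1 := hB.trans (hA B)
  have h2 : G * Real.sqrt (D * T) * L ^ a ≤ G * (2 * Real.sqrt (T * m * b)) * L ^ a := by gcongr
  have h3 : Real.sqrt (T * m * b) / 192 * (κ * L ^ a) ≤ Real.sqrt (T * m * b) / 192 *
      (T / (b ^ 2 * m) : ℝ) ^ (1 / (2 * m : ℝ)) := by gcongr
  have h4 : 0 < Real.sqrt (T * m * b) * L ^ a := by positivity
  have h5 := h3.trans (h1.trans h2)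
  have h6 : G * (2 * Real.sqrt (T * m * b)) * L ^ a =
      2 * G * (Real.sqrt (T * m * b) * L ^ a) := by ring
  have h7 : Real.sqrt (T * m * b) / 192 * (κ * L ^ a) =
      (2 * G + 1 / 64) * (Real.sqrt (T * m * b) * L ^ a) := by rw [hκ]; ring
  rw [h6, h7] at h5
  linarith

end

end LinBandit

theorem mainTheorem6 :
    (∃ C : ℝ, 0 < C ∧
      ∀ (d T : ℕ) (M : ℝ), Even d → 2 ≤ d → C * d ≤ T →
        20 * d ≤ M → M ≤ d * Real.log T / 48 →
        ∀ A : LinBandit.Learner d 2,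
          (∀ B : LinBandit.Instance d 2, A.expectedSwitches B T ≤ ENNReal.ofReal M) →
          ∃ B : LinBandit.Instance d 2,
            Real.sqrt (d * T) * (1 / (32 * d)) * (2 * T / d : ℝ) ^ (1 / (16 * M / d + 2))
              ≤ A.expectedRegret B T) ∧
    (∀ a : ℝ, 0 ≤ a → ∃ c : ℝ, 0 < c ∧ ∀ G : ℝ, 0 < G → ∃ T₀ : ℝ, 0 < T₀ ∧
      ∀ d T : ℕ, Even d → 2 ≤ d → T₀ ≤ T → T₀ * d ^ 2 * Real.log T ^ (2 * a) ≤ T →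
        ∀ A : LinBandit.Learner d 2,
          (∀ B : LinBandit.Instance d 2,
            A.expectedRegret B T ≤ G * Real.sqrt (d * T) * Real.log T ^ a) →
          ∃ B : LinBandit.Instance d 2,
            ENNReal.ofReal (c * (d * Real.log T / Real.log (d * Real.log T)))
              ≤ A.expectedSwitches B T) := by
  -- `C = 1` suffices, as horizons too short for the digit construction are covered by the bound
  -- without switches.
  refine ⟨⟨1, one_pos, fun d T M _ hd hdT hM hMT A hA => ?_⟩, fun a ha => ?_⟩
  · exact LinBandit.exists_expectedRegret_ge_of_switches_le hd (by linarith) hM hMT A hA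
  · obtain ⟨c, hc, h⟩ := LinBandit.exists_switches_ge_of_expectedRegret_le ha
    refine ⟨c, hc, fun G hG => ?_⟩
    obtain ⟨T₀, hT₀, h⟩ := h G hG
    exact ⟨T₀, hT₀, fun d T _ hd hT hT2 A hA => h d T hd hT hT2 A hA⟩
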